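/- Let $M$ be a smooth manifold with a regular foliation $\mathcal{F}$ of dimension $p$ and codimension $2n$. Let $\{U_i\}_{i}$ be an open cover of $M$ with smooth submersions $p_i : U_i \to \mathbb{R}^{2n}$ such that $\mathcal{F}|_{U_i}$ is given by the fibres of $p_i$, i.e. the leaves of $\mathcal{F}|_{U_i}$ are exactly the (connected) fibres of $p_i$. Let $N = \coprod_i p_i(U_i)$ be the associated transverse manifold, and let $\Gamma$ be the holonomy pseudogroup on $N$, i.e. the pseudogroup generated by the maps of the Haefliger cocycle of $(U_i, p_i)$: the diffeomorphisms $\gamma : p_j(W) \to p_i(W)$ with $\gamma \circ p_j|_W = p_i|_W$, where $W \subseteq U_i \cap U_j$ is open. Let $$\Omega^k_B(M,\mathcal{F}) = \{\xi \in \Omega^k(M) : \iota_T \xi = \mathcal{L}_T \xi = 0 \text{ for every vector field } T \text{ on } M \text{ tangent to } \mathcal{F}\}$$ be the space of basic $k$-forms, and let $$\Omega^k_\Gamma(N) = \{\eta \in \Omega^k(N) : \eta|_{U} = \gamma^*(\eta|_{\gamma(U)}) \text{ for every } \gamma \in \Gamma \text{ with domain } U\}$$ be the space of $\Gamma$-invariant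 $k$-forms on $N$. Then $\Omega^*_B(M,\mathcal{F})$ and $\Omega^*_\Gamma(N)$ are closed under the exterior derivative and the wedge product and contain the constant function $1$, and there is an isomorphism of cochain complexes $$\Xi : \Omega^*_B(M,\mathcal{F}) \xrightarrow{\ \cong\ } \Omega^*_\Gamma(N)$$ (linear isomorphisms in every degree that commute with $d$) such that $$\xi|_{U_i} = p_i^*\bigl(\Xi(\xi)|_{p_i(U_i)}\bigr) \quad \text{for every } \xi \in \Omega^*_B(M,\mathcal{F}) \text{ and every } i.$$ Moreover, $\Xi$ is a homomorphism of algebras: $\Xi(\xi \wedge \eta) = \Xi(\xi) \wedge \Xi(\eta)$ and $\Xi(1) = 1$. -/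

import Mathlib

open scoped Manifold ContDiff Topology
open Set TopologicalSpace

noncomputable section

namespace FoliatedForms

/-! ### Differential forms on a manifold without boundary, modelled on a normed space -/

section Forms

variable {E : Type*} [NormedAddCommGroup E] [NormedSpace ℝ E]
  {F : Type*} [NormedAddCommGroup F] [NormedSpace ℝ F]
  {M : Type*} [TopologicalSpace M] [ChartedSpace E M]
  {N : Type*} [TopologicalSpace N] [ChartedSpace F N] {k l : ℕ}

/-- Real-valued differential `k`-forms on `M`, not necessarily smooth: an alternating `k`-linear
form on every tangent space. -/
abbrev DiffForm (E : Type*) [NormedAddCommGroup E] [NormedSpace ℝ E]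
    (M : Type*) [TopologicalSpace M] [ChartedSpace E M] (k : ℕ) : Type _ :=
  ∀ x : M, (TangentSpace 𝓘(ℝ, E) x) [⋀^Fin k]→L[ℝ] ℝ

/-- The pullback `f^* α`. -/
def pullback (f : M → N) (α : DiffForm F N k) : DiffForm E M k := fun x =>
  (α (f x)).compContinuousLinearMap (mfderiv 𝓘(ℝ, E) 𝓘(ℝ, F) f x)

/-- The local expression of `α` in the chart `e`, i.e. the pullback of `α` by `e⁻¹`
(only meaningful on the open set `e.target`). -/
def inChart (e : OpenPartialHomeomorph M E) (α : DiffForm E M k) : E → E [⋀^Fin k]→L[ℝ] ℝ :=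
  fun y => pullback (E := E) (M := E) e.symm α y

/-- `α` is smooth: its local expressions in all the charts of the atlas are smooth. -/
def IsSmoothForm (α : DiffForm E M k) : Prop :=
  ∀ e ∈ atlas E M, ContDiffOn ℝ ∞ (inChart e α) e.target

/-- The exterior derivative; at `x` it is computed in the preferred chart at `x`. -/
def extDer (α : DiffForm E M k) : DiffForm E M (k + 1) := fun x =>
  ContinuousAlternatingMap.compContinuousLinearMap
    (extDeriv (inChart (chartAt E x) α) (chartAt E x x))
    (mfderiv 𝓘(ℝ, E) 𝓘(ℝ, E) (chartAt E x) x)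

/-- The interior product (contraction) `ι_T α` with a vector field `T`, in positive degree. -/
def interiorProd (T : ∀ x : M, TangentSpace 𝓘(ℝ, E) x) (α : DiffForm E M (k + 1)) :
    DiffForm E M k := fun x =>
  ContinuousAlternatingMap.curryLeft (E := E) (α x) (T x)

/-- `ι_T α = 0`; a condition that is empty for `0`-forms, whose contraction is zero. -/
def InteriorEqZero (T : ∀ x : M, TangentSpace 𝓘(ℝ, E) x) :
    ∀ {k : ℕ}, DiffForm E M k → Prop
  | 0, _ => True
  | _ + 1, α => interiorProd T α = 0

/-- The Lie derivative of a form, `L_T = d ∘ ι_T + ι_T ∘ d`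
(on `0`-forms this is `f ↦ df(T)`). -/
def lieDer (T : ∀ x : M, TangentSpace 𝓘(ℝ, E) x) :
    ∀ {k : ℕ}, DiffForm E M k → DiffForm E M k
  | 0, α => interiorProd T (extDer α)
  | _ + 1, α => extDer (interiorProd T α) + interiorProd T (extDer α)

/-- The wedge product of two alternating forms on a vector space (the sum over shuffles):
`(a ∧ b)(v₁, …, v_{k+l}) = ∑_σ sign σ a(v_{σ1}, …, v_{σk}) b(v_{σ(k+1)}, …, v_{σ(k+l)})`. -/
def wedgeAlg {V : Type*} [AddCommGroup V] [Module ℝ V]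
    (a : V [⋀^Fin k]→ₗ[ℝ] ℝ) (b : V [⋀^Fin l]→ₗ[ℝ] ℝ) : V [⋀^Fin (k + l)]→ₗ[ℝ] ℝ :=
  ((LinearMap.mul' ℝ ℝ).compAlternatingMap (a.domCoprod b)).domDomCongr finSumFinEquiv

theorem continuous_wedgeAlg {V : Type*} [AddCommGroup V] [Module ℝ V] [TopologicalSpace V]
    (a : V [⋀^Fin k]→L[ℝ] ℝ) (b : V [⋀^Fin l]→L[ℝ] ℝ) :
    Continuous (wedgeAlg a.toAlternatingMap b.toAlternatingMap) := by
  have h : ∀ v, wedgeAlg a.toAlternatingMap b.toAlternatingMap v =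
      ∑ σ : Equiv.Perm.ModSumCongr (Fin k) (Fin l), LinearMap.mul' ℝ ℝ
        (AlternatingMap.domCoprod.summand a.toAlternatingMap b.toAlternatingMap σ
          (v ∘ finSumFinEquiv)) := by
    intro v
    simp [wedgeAlg, AlternatingMap.domCoprod, Function.comp_def]
  rw [funext h]
  refine continuous_finsetSum _ fun σ _ => ?_
  induction σ using Quotient.inductionOn' with
  | h σ =>
    have h' : ∀ v : Fin (k + l) → V, LinearMap.mul' ℝ ℝ
        (AlternatingMap.domCoprod.summand a.toAlternatingMap b.toAlternatingMap
          (Quotient.mk'' σ) (v ∘ finSumFinEquiv)) =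
        Equiv.Perm.sign σ • (a (fun i => v (finSumFinEquiv (σ (Sum.inl i)))) *
          b (fun i => v (finSumFinEquiv (σ (Sum.inr i))))) := by
      intro v
      rw [AlternatingMap.domCoprod.summand_mk'']
      rw [smul_apply, Units.smul_def, Units.smul_def, map_zsmul]
      rfl
    rw [funext h']
    have hc : ∀ c : Fin k ⊕ Fin l, Continuous fun v : Fin (k + l) → V =>
      v (finSumFinEquiv (σ c)) := fun c => continuous_apply _
    have h1 : Continuous fun v : Fin (k + l) → V =>
        a (fun i => v (finSumFinEquiv (σ (Sum.inl i)))) :=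
      a.cont.comp (continuous_pi fun i => hc _)
    have h2 : Continuous fun v : Fin (k + l) → V =>
        b (fun i => v (finSumFinEquiv (σ (Sum.inr i)))) :=
      b.cont.comp (continuous_pi fun i => hc _)
    simp only [Units.smul_def]
    exact (h1.mul h2).zsmul _

/-- The wedge product of differential forms. -/
def wedge (α : DiffForm E M k) (η : DiffForm E M l) : DiffForm E M (k + l) := fun x =>
  { wedgeAlg (α x).toAlternatingMap (η x).toAlternatingMap with
    cont := continuous_wedgeAlg (α x) (η x) }

/-- The constant function `1`, as a `0`-form: the unit of the algebra of forms. -/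
def oneForm : DiffForm E M 0 := fun _ => ContinuousAlternatingMap.constOfIsEmpty ℝ _ (Fin 0) 1

/-- A smooth vector field on `M`. -/
def IsSmoothVectorField [IsManifold 𝓘(ℝ, E) ∞ M] (T : ∀ x : M, TangentSpace 𝓘(ℝ, E) x) : Prop :=
  ContMDiff 𝓘(ℝ, E) (𝓘(ℝ, E).prod 𝓘(ℝ, E)) ∞ (fun x => (⟨x, T x⟩ : TangentBundle 𝓘(ℝ, E) M))

theorem inChart_add (e : OpenPartialHomeomorph M E) (α η : DiffForm E M k) :
    inChart e (α + η) = inChart e α + inChart e η := rfl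

theorem inChart_smul (e : OpenPartialHomeomorph M E) (c : ℝ) (α : DiffForm E M k) :
    inChart e (c • α) = c • inChart e α := rfl

theorem inChart_zero (e : OpenPartialHomeomorph M E) :
    inChart e (0 : DiffForm E M k) = 0 := rfl

theorem isSmoothForm_zero : IsSmoothForm (0 : DiffForm E M k) := fun e _ => by
  rw [inChart_zero]; exact contDiffOn_const

theorem IsSmoothForm.add {α η : DiffForm E M k} (hα : IsSmoothForm α) (hη : IsSmoothForm η) :
    IsSmoothForm (α + η) := fun e he => by
  rw [inChart_add]; exact (hα e he).add (hη e he)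

theorem IsSmoothForm.smul (c : ℝ) {α : DiffForm E M k} (hα : IsSmoothForm α) :
    IsSmoothForm (c • α) := fun e he => by
  rw [inChart_smul]; exact (hα e he).const_smul c

theorem IsSmoothForm.differentiableAt {α : DiffForm E M k} (hα : IsSmoothForm α) (x : M) :
    DifferentiableAt ℝ (inChart (chartAt E x) α) (chartAt E x x) :=
  ((hα _ (chart_mem_atlas E x)).contDiffAt
    ((chartAt E x).open_target.mem_nhds (mem_chart_target E x))).differentiableAt (by simp)

theorem extDer_zero : extDer (0 : DiffForm E M k) = 0 := by
  funext x
  have h : extDeriv (0 : E → E [⋀^Fin k]→L[ℝ] ℝ) (chartAt E x x) = 0 := by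
    have := extDeriv_smul (x := chartAt E x x) (0 : ℝ) (0 : E → E [⋀^Fin k]→L[ℝ] ℝ)
    simpa using this
  rw [extDer, inChart_zero, h]; rfl

theorem extDer_add {α η : DiffForm E M k} (hα : IsSmoothForm α) (hη : IsSmoothForm η) :
    extDer (α + η) = extDer α + extDer η := by
  funext x
  rw [extDer, inChart_add, extDeriv_add (hα.differentiableAt x) (hη.differentiableAt x)]; rfl

theorem extDer_smul (c : ℝ) (α : DiffForm E M k) : extDer (c • α) = c • extDer α := by
  funext x
  rw [extDer, inChart_smul, extDeriv_smul]; rfl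

theorem interiorProd_zero (T : ∀ x : M, TangentSpace 𝓘(ℝ, E) x) :
    interiorProd T (0 : DiffForm E M (k + 1)) = 0 := by
  funext x
  exact DFunLike.congr_fun (ContinuousAlternatingMap.curryLeft_zero (E := E)) _

theorem interiorProd_add (T : ∀ x : M, TangentSpace 𝓘(ℝ, E) x) (α η : DiffForm E M (k + 1)) :
    interiorProd T (α + η) = interiorProd T α + interiorProd T η := by
  funext x
  exact DFunLike.congr_fun (ContinuousAlternatingMap.curryLeft_add (E := E) (α x) (η x)) _

theorem interiorProd_smul (T : ∀ x : M, TangentSpace 𝓘(ℝ, E) x) (c : ℝ) (α : DiffForm E M (k + 1)) :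
    interiorProd T (c • α) = c • interiorProd T α := by
  funext x
  exact DFunLike.congr_fun (ContinuousAlternatingMap.curryLeft_smul (E := E) c (α x)) _

/-- For a form with `ι_T α = 0`, the Lie derivative is `ι_T dα`. -/
theorem lieDer_of_interiorEqZero {T : ∀ x : M, TangentSpace 𝓘(ℝ, E) x} {α : DiffForm E M k}
    (h : InteriorEqZero T α) : lieDer T α = interiorProd T (extDer α) := by
  cases k with
  | zero => rfl
  | succ k =>
    have h' : interiorProd T α = 0 := h
    simp only [lieDer, h', extDer_zero, zero_add]

theorem interiorEqZero_zero (T : ∀ x : M, TangentSpace 𝓘(ℝ, E) x) :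
    InteriorEqZero T (0 : DiffForm E M k) := by
  cases k with
  | zero => trivial
  | succ k => exact interiorProd_zero T

theorem InteriorEqZero.add {T : ∀ x : M, TangentSpace 𝓘(ℝ, E) x} {α η : DiffForm E M k}
    (hα : InteriorEqZero T α) (hη : InteriorEqZero T η) : InteriorEqZero T (α + η) := by
  cases k with
  | zero => trivial
  | succ k =>
    have h1 : interiorProd T α = 0 := hα
    have h2 : interiorProd T η = 0 := hη
    change interiorProd T (α + η) = 0
    rw [interiorProd_add, h1, h2, add_zero]

theorem InteriorEqZero.smul {T : ∀ x : M, TangentSpace 𝓘(ℝ, E) x} (c : ℝ) {α : DiffForm E M k}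
    (hα : InteriorEqZero T α) : InteriorEqZero T (c • α) := by
  cases k with
  | zero => trivial
  | succ k =>
    have h1 : interiorProd T α = 0 := hα
    change interiorProd T (c • α) = 0
    rw [interiorProd_smul, h1, smul_zero]

end Forms

/-! ### Differential graded subalgebras of the algebra of forms -/

section SubDGA

variable {E : Type*} [NormedAddCommGroup E] [NormedSpace ℝ E]
  {M : Type*} [TopologicalSpace M] [ChartedSpace E M]

/-- A graded family `S` of spaces of forms on which `d` is defined with `d² = 0` (a complex), and
which is stable under the wedge product and contains `1` (a graded algebra). -/
structure IsSubDGA (S : ∀ k : ℕ, Submodule ℝ (DiffForm E M k)) : Prop where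
  d_mem : ∀ k, ∀ α ∈ S k, extDer α ∈ S (k + 1)
  d_d : ∀ k, ∀ α ∈ S k, extDer (extDer α) = 0
  one_mem : oneForm ∈ S 0
  wedge_mem : ∀ k l, ∀ α ∈ S k, ∀ η ∈ S l, wedge α η ∈ S (k + l)

variable {S : ∀ k : ℕ, Submodule ℝ (DiffForm E M k)}

/-- The differential of the complex `S`. -/
def IsSubDGA.d (h : IsSubDGA S) {k : ℕ} (α : S k) : S (k + 1) :=
  ⟨extDer α.1, h.d_mem k α.1 α.2⟩

/-- The product of the graded algebra `S`. -/
def IsSubDGA.mul (h : IsSubDGA S) {k l : ℕ} (α : S k) (η : S l) : S (k + l) :=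
  ⟨wedge α.1 η.1, h.wedge_mem k l α.1 α.2 η.1 η.2⟩

/-- The unit of the graded algebra `S`. -/
def IsSubDGA.one (h : IsSubDGA S) : S 0 := ⟨oneForm, h.one_mem⟩

end SubDGA

/-! ### Disjoint unions of open subsets of a normed space -/

section DisjUnion

variable {F : Type*} [NormedAddCommGroup F] {ι : Type*}

/-- The disjoint union `∐ V i` of a family of open sets of `F`. -/
abbrev DisjUnion (V : ι → Opens F) : Type _ := Σ i, V i

variable (V : ι → Opens F)

/-- The chart of `∐ V i` whose domain is the summand that contains `z`: it is the inclusion of that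
summand in `F`. -/
def DisjUnion.chart (z : DisjUnion V) : OpenPartialHomeomorph (DisjUnion V) F :=
  haveI : Nonempty (V z.1) := ⟨z.2⟩
  OpenPartialHomeomorph.trans
    (Topology.IsOpenEmbedding.toOpenPartialHomeomorph (Sigma.mk (β := fun i => V i) z.1)
      Topology.IsOpenEmbedding.sigmaMk).symm
    ((V z.1).openPartialHomeomorphSubtypeCoe ⟨z.2⟩)

theorem DisjUnion.chart_source (z : DisjUnion V) :
    (DisjUnion.chart V z).source = range (Sigma.mk (β := fun i => V i) z.1) := by
  have : Nonempty (V z.1) := ⟨z.2⟩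
  rw [DisjUnion.chart, OpenPartialHomeomorph.trans_source]
  simp only [OpenPartialHomeomorph.symm_source, Opens.openPartialHomeomorphSubtypeCoe_source,
    preimage_univ, inter_univ]
  exact Topology.IsOpenEmbedding.toOpenPartialHomeomorph_target _ _

theorem DisjUnion.chart_apply (z : DisjUnion V) (y : V z.1) :
    DisjUnion.chart V z (⟨z.1, y⟩ : Σ i, V i) = (y : F) := by
  have : Nonempty (V z.1) := ⟨z.2⟩
  have h := Topology.IsOpenEmbedding.toOpenPartialHomeomorph_left_inv
    (Sigma.mk (β := fun i => V i) z.1) Topology.IsOpenEmbedding.sigmaMk (x := y)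
  change (((Topology.IsOpenEmbedding.toOpenPartialHomeomorph
    (Sigma.mk (β := fun i => V i) z.1)
      Topology.IsOpenEmbedding.sigmaMk).symm ⟨z.1, y⟩ : V z.1) : F) = y
  rw [h]

instance : ChartedSpace F (DisjUnion V) where
  atlas := range (DisjUnion.chart V)
  chartAt := DisjUnion.chart V
  mem_chart_source z := by rw [DisjUnion.chart_source]; exact ⟨z.2, rfl⟩
  chart_mem_atlas z := ⟨z, rfl⟩

/-- All changes of charts are restrictions of the identity, so `∐ V i` is a smooth manifold. -/
instance [NormedSpace ℝ F] : IsManifold 𝓘(ℝ, F) ∞ (DisjUnion V) := by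
  refine isManifold_of_contDiffOn _ _ _ ?_
  rintro _ _ ⟨z, rfl⟩ ⟨w, rfl⟩
  simp only [modelWithCornersSelf_coe, modelWithCornersSelf_coe_symm, Function.comp_id,
    Function.id_comp, range_id, inter_univ, preimage_id]
  refine contDiffOn_id.congr ?_
  intro y hy
  have hy1 : y ∈ (DisjUnion.chart V z).target := by
    have := hy; simp only [OpenPartialHomeomorph.trans_source,
      OpenPartialHomeomorph.symm_source, mem_inter_iff] at this; exact this.1
  have hy2 : (DisjUnion.chart V z).symm y ∈ (DisjUnion.chart V w).source := by
    have := hy; simp only [OpenPartialHomeomorph.trans_source,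
      OpenPartialHomeomorph.symm_source, mem_inter_iff] at this; exact this.2
  have hz := (DisjUnion.chart V z).map_target hy1
  have hr := (DisjUnion.chart V z).right_inv hy1
  rw [DisjUnion.chart_source] at hz hy2
  obtain ⟨a, ha⟩ := hz
  obtain ⟨b, hb⟩ := hy2
  have h1 : DisjUnion.chart V z ((DisjUnion.chart V z).symm y) = (a : F) := by
    rw [← ha]; exact DisjUnion.chart_apply V z a
  have h2 : DisjUnion.chart V w ((DisjUnion.chart V z).symm y) = (b : F) := by
    rw [← hb]; exact DisjUnion.chart_apply V w b
  have h3 : (b : F) = (a : F) := by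
    have hab : (⟨w.1, b⟩ : Σ i, V i) = ⟨z.1, a⟩ := hb.trans ha.symm
    exact congrArg (fun s : Σ i, V i => (s.2 : F)) hab
  change DisjUnion.chart V w ((DisjUnion.chart V z).symm y) = y
  rw [h2, h3, ← h1, hr]

end DisjUnion

/-! ### Foliations, basic forms -/

section Foliation

variable {E : Type*} [NormedAddCommGroup E] [NormedSpace ℝ E]
  {F : Type*} [NormedAddCommGroup F] [NormedSpace ℝ F]
  {M : Type*} [TopologicalSpace M] [ChartedSpace E M]

/-- `f` is a smooth submersion. -/
def IsSmoothSubmersion {X : Type*} [TopologicalSpace X] [ChartedSpace E X] (f : X → F) : Prop :=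
  ContMDiff 𝓘(ℝ, E) 𝓘(ℝ, F) ∞ f ∧
    ∀ x, Function.Surjective (mfderiv 𝓘(ℝ, E) 𝓘(ℝ, F) f x)

/-- On the open set `U`, the distribution `D` consists of the vectors tangent to the fibres of
`f : U → F`. -/
def IsTangentToFibres (D : ∀ x : M, Submodule ℝ (TangentSpace 𝓘(ℝ, E) x)) (U : Opens M)
    (f : U → F) : Prop :=
  ∀ (x : U) (v : TangentSpace 𝓘(ℝ, E) x),
    mfderiv 𝓘(ℝ, E) 𝓘(ℝ, E) (Subtype.val : U → M) x v ∈ D x.1 ↔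
      mfderiv 𝓘(ℝ, E) 𝓘(ℝ, F) f x v = 0

variable (E F M) in
/-- A regular (smooth) foliation of `M` of codimension `dim F`, given by its tangent distribution:
near every point the distribution consists of the tangent spaces of the fibres of a submersion
to `F`. -/
structure Foliation where
  /-- The tangent distribution of the foliation. -/
  tangent : ∀ x : M, Submodule ℝ (TangentSpace 𝓘(ℝ, E) x)
  exists_submersion : ∀ x : M, ∃ (U : Opens M) (f : U → F), x ∈ U ∧
    IsSmoothSubmersion (E := E) f ∧ IsTangentToFibres tangent U f

/-- `T` is a (smooth, globally defined) vector field tangent to the foliation. -/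
def Foliation.IsTangentField [IsManifold 𝓘(ℝ, E) ∞ M] (ℱ : Foliation E F M)
    (T : ∀ x : M, TangentSpace 𝓘(ℝ, E) x) : Prop :=
  IsSmoothVectorField T ∧ ∀ x, T x ∈ ℱ.tangent x

/-- The space `Ω^k_B(M, ℱ)` of basic `k`-forms: the smooth forms `ξ` with `ι_T ξ = L_T ξ = 0` for
every vector field `T` tangent to the foliation. -/
def basicForms [IsManifold 𝓘(ℝ, E) ∞ M] (ℱ : Foliation E F M) (k : ℕ) :
    Submodule ℝ (DiffForm E M k) where
  carrier := {ξ | IsSmoothForm ξ ∧ ∀ T, ℱ.IsTangentField T → InteriorEqZero T ξ ∧ lieDer T ξ = 0}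
  zero_mem' := ⟨isSmoothForm_zero, fun T _ => ⟨interiorEqZero_zero T, by
    rw [lieDer_of_interiorEqZero (interiorEqZero_zero T), extDer_zero, interiorProd_zero]⟩⟩
  add_mem' := by
    rintro ξ η ⟨hξ, hξ'⟩ ⟨hη, hη'⟩
    refine ⟨hξ.add hη, fun T hT => ⟨(hξ' T hT).1.add (hη' T hT).1, ?_⟩⟩
    have h1 := (hξ' T hT).2
    have h2 := (hη' T hT).2
    rw [lieDer_of_interiorEqZero (hξ' T hT).1] at h1
    rw [lieDer_of_interiorEqZero (hη' T hT).1] at h2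
    rw [lieDer_of_interiorEqZero ((hξ' T hT).1.add (hη' T hT).1), extDer_add hξ hη,
      interiorProd_add, h1, h2, add_zero]
  smul_mem' := by
    rintro c ξ ⟨hξ, hξ'⟩
    refine ⟨hξ.smul c, fun T hT => ⟨(hξ' T hT).1.smul c, ?_⟩⟩
    have h1 := (hξ' T hT).2
    rw [lieDer_of_interiorEqZero (hξ' T hT).1] at h1
    rw [lieDer_of_interiorEqZero ((hξ' T hT).1.smul c), extDer_smul, interiorProd_smul, h1, smul_zero]

end Foliation

/-! ### Invariant forms -/

section Invariant

variable {F : Type*} [NormedAddCommGroup F] [NormedSpace ℝ F]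
  {N : Type*} [TopologicalSpace N] [ChartedSpace F N]

variable (F) in
/-- The space `Ω^k_Γ(N)` of smooth `k`-forms `η` with `η|_U = γ^*(η|_{γ(U)})` for every `γ` in the
pseudogroup `Γ`, where `U` is the domain of `γ`. -/
def invariantForms (Γ : StructureGroupoid N) (k : ℕ) : Submodule ℝ (DiffForm F N k) where
  carrier := {η | IsSmoothForm η ∧ ∀ γ ∈ Γ, ∀ x ∈ γ.source, η x = pullback γ η x}
  zero_mem' := ⟨isSmoothForm_zero, fun _ _ _ _ => rfl⟩
  add_mem' := by
    rintro ξ η ⟨hξ, hξ'⟩ ⟨hη, hη'⟩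
    refine ⟨hξ.add hη, fun γ hγ x hx => ?_⟩
    rw [Pi.add_apply, hξ' γ hγ x hx, hη' γ hγ x hx]; rfl
  smul_mem' := by
    rintro c ξ ⟨hξ, hξ'⟩
    refine ⟨hξ.smul c, fun γ hγ x hx => ?_⟩
    rw [Pi.smul_apply, hξ' γ hγ x hx]; rfl

/-- The pseudogroup generated by a set `S` of local homeomorphisms: the smallest one that
contains `S` (pseudogroups being closed under composition, inversion, restriction to open sets and
gluing, and containing the identity). -/
def generatedPseudogroup (S : Set (OpenPartialHomeomorph N N)) : StructureGroupoid N :=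
  sInf {G | ClosedUnderRestriction G ∧ S ⊆ G.members}

end Invariant

/-! ### Foliated atlases, the transverse manifold and the holonomy pseudogroup -/

section Atlas

variable {E : Type*} [NormedAddCommGroup E] [NormedSpace ℝ E]
  {F : Type*} [NormedAddCommGroup F] [NormedSpace ℝ F]
  {M : Type*} [TopologicalSpace M] [ChartedSpace E M]

/-- An open cover `U i` of `M` with submersions `p i : U i → F` such that the foliation restricted
to `U i` is given by the fibres of `p i`: its tangent spaces are those of the fibres, and the
fibres are connected, so that they are exactly the leaves of the restricted foliation. -/
structure FoliatedAtlas (ℱ : Foliation E F M) (ι : Type*) where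
  /-- The open sets of the atlas. -/
  U : ι → Opens M
  covers : ∀ x : M, ∃ i, x ∈ U i
  /-- The submersions. -/
  p : ∀ i, U i → F
  submersion : ∀ i, IsSmoothSubmersion (E := E) (p i)
  tangent : ∀ i, IsTangentToFibres ℱ.tangent (U i) (p i)
  connected : ∀ i y, IsPreconnected (p i ⁻¹' {y})

theorem IsSmoothSubmersion.isOpen_range [CompleteSpace E] [CompleteSpace F]
    {X : Type*} [TopologicalSpace X] [ChartedSpace E X] {f : X → F}
    (hf : IsSmoothSubmersion (E := E) f) : IsOpen (range f) := by
  rw [isOpen_iff_mem_nhds]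
  rintro _ ⟨x, rfl⟩
  have hd := (hf.1 x).mdifferentiableAt (by simp)
  have hs := hf.2 x
  rw [hd.mfderiv] at hs
  have hc : ContDiffAt ℝ ∞ (writtenInExtChartAt 𝓘(ℝ, E) 𝓘(ℝ, F) x f)
      (extChartAt 𝓘(ℝ, E) x x) := by
    have := (contMDiffAt_iff.1 (hf.1 x)).2
    simpa [contDiffWithinAt_univ, writtenInExtChartAt] using this
  have hst := hc.hasStrictFDerivAt (by simp)
  have hmap := hst.map_nhds_eq_of_surj (by
    rw [LinearMap.range_eq_top]
    simp only [modelWithCornersSelf_coe, range_id, fderivWithin_univ] at hs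
    exact hs)
  have hx : writtenInExtChartAt 𝓘(ℝ, E) 𝓘(ℝ, F) x f (extChartAt 𝓘(ℝ, E) x x) = f x := by
    simp [writtenInExtChartAt, chartAt_self_eq]
  rw [hx] at hmap
  rw [← hmap]
  refine Filter.mem_map.2 (Filter.Eventually.of_forall fun y => ?_)
  simp [writtenInExtChartAt, chartAt_self_eq]

variable [CompleteSpace E] [CompleteSpace F] {ℱ : Foliation E F M} {ι : Type*}

/-- The open set `p i (U i)`. -/
def FoliatedAtlas.image (A : FoliatedAtlas ℱ ι) (i : ι) : Opens F :=
  ⟨range (A.p i), (A.submersion i).isOpen_range⟩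

/-- The transverse manifold `N = ∐ p i (U i)`. -/
abbrev FoliatedAtlas.Transverse (A : FoliatedAtlas ℱ ι) : Type _ := DisjUnion A.image

/-- The submersion `p i`, as a map from `U i` to the summand `p i (U i)` of the transverse
manifold. -/
def FoliatedAtlas.proj (A : FoliatedAtlas ℱ ι) (i : ι) (x : A.U i) : A.Transverse :=
  (⟨i, ⟨A.p i x, mem_range_self x⟩⟩ : Σ i, A.image i)

/-- The mappings of the Haefliger cocycle of the atlas: the diffeomorphisms
`γ : p j (W) → p i (W)` between open sets of the transverse manifold with `γ ∘ p j = p i` on `W`,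
for an open set `W ⊆ U i ∩ U j`. If there is one for `W = U i ∩ U j`, then those for smaller `W` are
its restrictions. -/
def FoliatedAtlas.IsTransition (A : FoliatedAtlas ℱ ι)
    (γ : OpenPartialHomeomorph A.Transverse A.Transverse) : Prop :=
  ContMDiffOn 𝓘(ℝ, F) 𝓘(ℝ, F) ∞ γ γ.source ∧ ContMDiffOn 𝓘(ℝ, F) 𝓘(ℝ, F) ∞ γ.symm γ.target ∧
  ∃ (i j : ι) (W : Opens M) (hi : W ≤ A.U i) (hj : W ≤ A.U j),
    γ.source = range (fun x : W => A.proj j ⟨x, hj x.2⟩) ∧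
    ∀ x : W, γ (A.proj j ⟨x, hj x.2⟩) = A.proj i ⟨x, hi x.2⟩

/-- The holonomy pseudogroup on the transverse manifold, generated by the Haefliger cocycle. -/
def FoliatedAtlas.holonomyPseudogroup (A : FoliatedAtlas ℱ ι) :
    StructureGroupoid A.Transverse :=
  generatedPseudogroup {γ | A.IsTransition γ}

end Atlas

end FoliatedForms

end

noncomputable section

namespace FoliatedForms

/-! ### Pullback, smoothness and exterior derivative of forms, in charts -/

section Calculus

variable {E : Type*} [NormedAddCommGroup E] [NormedSpace ℝ E]
  {F : Type*} [NormedAddCommGroup F] [NormedSpace ℝ F]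
  {G : Type*} [NormedAddCommGroup G] [NormedSpace ℝ G]
  {M : Type*} [TopologicalSpace M] [ChartedSpace E M]
  {N : Type*} [TopologicalSpace N] [ChartedSpace F N]
  {P : Type*} [TopologicalSpace P] [ChartedSpace G P] {k l : ℕ}

/-! Say that a form `ξ` on `M` and a form `η` on the transverse manifold correspond
(`FoliatedAtlas.Corresponds`) if `ξ` restricts on every `U i` to the pullback of `η` by `A.proj i`.
This relation is the graph of the isomorphism. It is compatible with sums, scalars, `d`, the wedge
product and `1`, because pullback is; and each of the two forms determines the other, because the `U
i` cover `M` and the projections are jointly onto with surjective differentials. It remains to see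
that the relation pairs every basic form with an invariant one and conversely.

From `M` to the transverse manifold: every vector tangent to the foliation extends to a global
tangent field (`Foliation.exists_tangentField`), and the Lie derivative of `ξ` is the contraction of
`dξ` once the contraction of `ξ` vanishes. So `ξ` is basic exactly when tangent vectors annihilate
both `ξ` and `dξ` (`mem_basicForms_iff`). Straighten a submersion to a projection of a product of
balls: then `ξ` involves no vertical covectors, and the vanishing of the contraction of `dξ` makes
its coefficients constant along the vertical directions, so `ξ` is locally a pullback
(`exists_local_descent`). The local forms downstairs are unique, hence their values are locally
constant along the fibres of the submersion, and connectedness of the fibres glues them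
(`exists_descent`).

From the transverse manifold to `M`: on an overlap, `p i` factors locally through `p j` by a
diffeomorphism, since both differentials have the tangent distribution as kernel. Thus the Haefliger
cocycle has enough elements (`FoliatedAtlas.exists_transition`) for invariance to make the pullbacks
by the various projections agree.

Conversely, if a smooth `η` corresponds to some `ξ`, then `ξ` is basic, and `η` is preserved by the
cocycle. The local diffeomorphisms preserving `η` form a pseudogroup (`symmetryGroupoid`), so `η` is
preserved by the whole holonomy pseudogroup. Closure under `d` and the wedge product is deduced on
both sides from this transfer. -/

theorem pullback_comp_apply {g : N → P} {f : M → N} {x : M} (α : DiffForm G P k)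
    (hg : MDifferentiableAt 𝓘(ℝ, F) 𝓘(ℝ, G) g (f x))
    (hf : MDifferentiableAt 𝓘(ℝ, E) 𝓘(ℝ, F) f x) :
    pullback (E := E) (g ∘ f) α x = pullback f (pullback (E := F) g α) x := by
  unfold pullback
  rw [mfderiv_comp x hg hf]
  rfl

theorem pullback_congr_map {f g : M → N} {x : M} (h : f =ᶠ[𝓝 x] g) (α : DiffForm F N k) :
    pullback (E := E) f α x = pullback g α x := by
  have h1 : f x = g x := h.self_of_nhds
  have h2 : (mfderiv 𝓘(ℝ, E) 𝓘(ℝ, F) f x : E →L[ℝ] F) = mfderiv 𝓘(ℝ, E) 𝓘(ℝ, F) g x :=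
    h.mfderiv_eq
  -- The type of `α y` depends on `y`; the ascription to forms on `F` makes the base point
  -- rewritable.
  have h3 : ∀ y z : N, y = z → (α y : F [⋀^Fin k]→L[ℝ] ℝ) = α z := by
    rintro y _ rfl; rfl
  change ContinuousAlternatingMap.compContinuousLinearMap (α (f x) : F [⋀^Fin k]→L[ℝ] ℝ)
    (mfderiv 𝓘(ℝ, E) 𝓘(ℝ, F) f x : E →L[ℝ] F) =
    ContinuousAlternatingMap.compContinuousLinearMap (α (g x) : F [⋀^Fin k]→L[ℝ] ℝ)
    (mfderiv 𝓘(ℝ, E) 𝓘(ℝ, F) g x : E →L[ℝ] F)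
  rw [h2, h3 _ _ h1]
  rfl

theorem pullback_congr_form {f : M → N} {x : M} {α η : DiffForm F N k} (h : α (f x) = η (f x)) :
    pullback (E := E) f α x = pullback f η x := by
  unfold pullback
  rw [h]

theorem pullback_id_apply (α : DiffForm E M k) (x : M) : pullback (E := E) id α x = α x := by
  unfold pullback
  rw [mfderiv_id]
  rfl

/-- Pullback by a map with surjective differential is injective, pointwise. -/
theorem eq_of_pullback_eq {f : M → N} {x : M} {α η : DiffForm F N k}
    (hf : Function.Surjective (mfderiv 𝓘(ℝ, E) 𝓘(ℝ, F) f x))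
    (h : pullback (E := E) f α x = pullback f η x) : α (f x) = η (f x) := by
  ext v
  choose w hw using fun i => hf (v i)
  have := DFunLike.congr_fun h w
  change α (f x) (fun i => mfderiv 𝓘(ℝ, E) 𝓘(ℝ, F) f x (w i)) =
    η (f x) (fun i => mfderiv 𝓘(ℝ, E) 𝓘(ℝ, F) f x (w i)) at this
  simpa only [hw] using this

/-- Smoothness of the form `α` at a point. -/
def SmoothFormAt (α : DiffForm E M k) (x : M) : Prop :=
  ContDiffAt ℝ ∞ (inChart (chartAt E x) α) (chartAt E x x)

theorem one_le_infty : (1 : WithTop ℕ∞) ≤ ∞ := WithTop.coe_le_coe.2 le_top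

theorem two_le_infty : (2 : WithTop ℕ∞) ≤ ∞ := WithTop.coe_le_coe.2 le_top

/-- The normalized alternatization, a continuous left inverse of the inclusion of the continuous
alternating maps in the continuous multilinear maps. -/
def altProj (E : Type*) [NormedAddCommGroup E] [NormedSpace ℝ E] (k : ℕ) :
    ContinuousMultilinearMap ℝ (fun _ : Fin k => E) ℝ →L[ℝ] E [⋀^Fin k]→L[ℝ] ℝ :=
  (k.factorial : ℝ)⁻¹ • LinearMap.mkContinuous
    { toFun := fun f => ContinuousMultilinearMap.alternatization f
      map_add' := map_add _
      map_smul' := fun c f => by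
        ext v
        simp only [ContinuousMultilinearMap.alternatization_apply_apply, RingHom.id_apply,
          _root_.smul_apply]
        change _ = c • (ContinuousMultilinearMap.alternatization f) v
        rw [ContinuousMultilinearMap.alternatization_apply_apply, Finset.smul_sum]
        exact Finset.sum_congr rfl fun σ _ => smul_comm _ _ _ }
    (k.factorial : ℝ) fun f => by
      refine ContinuousAlternatingMap.opNorm_le_bound _ (by positivity) fun v => ?_
      -- Permuting the arguments does not change the product of their norms, so each of the `k!`
      -- summands is bounded by the same quantity.
      have h : ∀ σ : Equiv.Perm (Fin k), ‖Equiv.Perm.sign σ • f (v ∘ σ)‖ ≤ ‖f‖ * ∏ i, ‖v i‖ := by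
        intro σ
        have h1 : ‖Equiv.Perm.sign σ • f (v ∘ σ)‖ = ‖f (v ∘ σ)‖ := by
          rcases Int.units_eq_one_or (Equiv.Perm.sign σ) with h | h <;> simp [h]
        rw [h1]
        refine (f.le_opNorm _).trans_eq ?_
        rw [← Equiv.prod_comp σ (fun i => ‖v i‖)]
        rfl
      have h2 := norm_sum_le_of_le Finset.univ fun σ _ => h σ
      simp only [LinearMap.coe_mk, AddHom.coe_mk,
        ContinuousMultilinearMap.alternatization_apply_apply]
      refine h2.trans_eq ?_
      simp [Finset.card_univ, Fintype.card_perm, mul_assoc]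

theorem altProj_toContinuousMultilinearMap (a : E [⋀^Fin k]→L[ℝ] ℝ) :
    altProj E k a.toContinuousMultilinearMap = a := by
  ext v
  have h : ∀ σ : Equiv.Perm (Fin k), Equiv.Perm.sign σ • a (v ∘ σ) = a v := by
    intro σ
    have := a.toAlternatingMap.map_perm v σ
    change a (v ∘ σ) = Equiv.Perm.sign σ • a v at this
    rw [this, smul_smul]
    simp
  have h2 : (ContinuousMultilinearMap.alternatization a.toContinuousMultilinearMap) v =
      (k.factorial : ℝ) * a v := by
    rw [ContinuousMultilinearMap.alternatization_apply_apply]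
    simp only [ContinuousAlternatingMap.coe_toContinuousMultilinearMap, h]
    simp [Finset.card_univ, Fintype.card_perm]
  change (k.factorial : ℝ)⁻¹ * (ContinuousMultilinearMap.alternatization
    a.toContinuousMultilinearMap) v = a v
  rw [h2, inv_mul_cancel_left₀]
  exact_mod_cast k.factorial_ne_zero

/-- For multilinear maps the composition is linear in the form and multilinear in the linear map,
hence smooth. The alternating case is reached by forgetting alternation and coming back with
`altProj`. -/
theorem contDiff_compContinuousLinearMap :
    ContDiff ℝ ∞ (fun q : (F [⋀^Fin k]→L[ℝ] ℝ) × (E →L[ℝ] F) =>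
      q.1.compContinuousLinearMap q.2) := by
  have h1 : ContDiff ℝ ∞ (fun q : (F [⋀^Fin k]→L[ℝ] ℝ) × (E →L[ℝ] F) =>
      (ContinuousMultilinearMap.compContinuousLinearMapContinuousMultilinear ℝ
        (fun _ : Fin k ↦ E) (fun _ ↦ F) ℝ (fun _ => q.2))
        (ContinuousAlternatingMap.toContinuousMultilinearMapCLM ℝ q.1)) := by
    refine ContDiff.clm_apply ?_ ?_
    · refine (ContinuousMultilinearMap.contDiff _).comp ?_
      exact contDiff_pi.2 fun _ => contDiff_snd
    · exact (ContinuousLinearMap.contDiff _).comp contDiff_fst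
  convert! (altProj E k).contDiff.comp h1 using 2 with q
  exact (altProj_toContinuousMultilinearMap (q.1.compContinuousLinearMap q.2)).symm

/-- In charts, the pullback of a form is the pullback of its local expression. -/
theorem inChart_pullback_eventuallyEq [IsManifold 𝓘(ℝ, E) ∞ M] [IsManifold 𝓘(ℝ, F) ∞ N]
    {f : M → N} {x : M} (hf : ContMDiffAt 𝓘(ℝ, E) 𝓘(ℝ, F) ∞ f x)
    {e : OpenPartialHomeomorph M E} (he : e ∈ IsManifold.maximalAtlas 𝓘(ℝ, E) ∞ M)
    (hx : x ∈ e.source) {e' : OpenPartialHomeomorph N F}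
    (he' : e' ∈ IsManifold.maximalAtlas 𝓘(ℝ, F) ∞ N) (hx' : f x ∈ e'.source)
    (α : DiffForm F N k) :
    inChart e (pullback f α) =ᶠ[𝓝 (e x)] fun y =>
      (inChart e' α ((e' ∘ f ∘ e.symm) y)).compContinuousLinearMap
        (fderiv ℝ (e' ∘ f ∘ e.symm) y) := by
  have : IsManifold 𝓘(ℝ, E) 1 M := IsManifold.of_le one_le_infty
  have : IsManifold 𝓘(ℝ, F) 1 N := IsManifold.of_le one_le_infty
  -- Smoothness of order `∞` at a point provides a neighbourhood for each finite order but no common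
  -- one; order one suffices for the chain rule near `x`.
  have hf1 : ∀ᶠ z in 𝓝 x, ContMDiffAt 𝓘(ℝ, E) 𝓘(ℝ, F) 1 f z :=
    (contMDiffAt_iff_contMDiffAt_nhds (by simp)).1 (hf.of_le one_le_infty)
  have hs : ∀ᶠ z in 𝓝 x, f z ∈ e'.source :=
    hf.continuousAt.eventually (e'.open_source.mem_nhds hx')
  have ht : Filter.Tendsto e.symm (𝓝 (e x)) (𝓝 x) := by
    have := e.continuousAt_symm (e.map_source hx)
    rwa [ContinuousAt, e.left_inv hx] at this
  filter_upwards [ht.eventually hf1, ht.eventually hs.eventually_nhds,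
    e.open_target.mem_nhds (e.map_source hx)] with y h1 h2 h3
  have de : MDifferentiableAt 𝓘(ℝ, E) 𝓘(ℝ, E) e.symm y :=
    (contMDiffAt_symm_of_mem_maximalAtlas he h3).mdifferentiableAt (by simp)
  have df : MDifferentiableAt 𝓘(ℝ, E) 𝓘(ℝ, F) f (e.symm y) := h1.mdifferentiableAt (by simp)
  have hy : f (e.symm y) ∈ e'.source := h2.self_of_nhds
  have de' : MDifferentiableAt 𝓘(ℝ, F) 𝓘(ℝ, F) e' (f (e.symm y)) :=
    (contMDiffAt_of_mem_maximalAtlas he' hy).mdifferentiableAt (by simp)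
  have de'' : MDifferentiableAt 𝓘(ℝ, F) 𝓘(ℝ, F) e'.symm (e' (f (e.symm y))) :=
    (contMDiffAt_symm_of_mem_maximalAtlas he' (e'.map_source hy)).mdifferentiableAt (by simp)
  have hφ : MDifferentiableAt 𝓘(ℝ, E) 𝓘(ℝ, F) (e' ∘ f ∘ e.symm) y :=
    de'.comp y (df.comp y de)
  have hev : f ∘ e.symm =ᶠ[𝓝 y] e'.symm ∘ (e' ∘ f ∘ e.symm) := by
    filter_upwards [(e.continuousAt_symm h3).eventually h2] with z hz
    exact (e'.left_inv hz).symm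
  have := pullback_comp_apply (E := E) (f := e.symm) (g := f) (x := y) α df de
  change pullback e.symm (pullback f α) y = _
  rw [← this, pullback_congr_map hev]
  refine (pullback_comp_apply (f := e' ∘ f ∘ e.symm) (g := e'.symm) α de'' hφ).trans ?_
  rw [← mfderiv_eq_fderiv]
  rfl

theorem ContDiffAt.compContinuousLinearMap_fderiv {a : F → F [⋀^Fin k]→L[ℝ] ℝ} {φ : E → F} {y : E}
    (ha : ContDiffAt ℝ ∞ a (φ y)) (hφ : ContDiffAt ℝ ∞ φ y) :
    ContDiffAt ℝ ∞ (fun z => (a (φ z)).compContinuousLinearMap (fderiv ℝ φ z)) y :=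
  contDiff_compContinuousLinearMap.contDiffAt.comp y
    ((ha.comp y hφ).prodMk (hφ.fderiv_right (by simp)))

theorem contDiffAt_chart_comp [IsManifold 𝓘(ℝ, E) ∞ M] [IsManifold 𝓘(ℝ, F) ∞ N]
    {f : M → N} {x : M} (hf : ContMDiffAt 𝓘(ℝ, E) 𝓘(ℝ, F) ∞ f x)
    {e : OpenPartialHomeomorph M E} (he : e ∈ IsManifold.maximalAtlas 𝓘(ℝ, E) ∞ M)
    (hx : x ∈ e.source) {e' : OpenPartialHomeomorph N F}
    (he' : e' ∈ IsManifold.maximalAtlas 𝓘(ℝ, F) ∞ N) (hx' : f x ∈ e'.source) :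
    ContDiffAt ℝ ∞ (e' ∘ f ∘ e.symm) (e x) := by
  rw [← contMDiffAt_iff_contDiffAt]
  have h1 := contMDiffAt_symm_of_mem_maximalAtlas he (e.map_source hx)
  have h2 : ContMDiffAt 𝓘(ℝ, E) 𝓘(ℝ, F) ∞ f (e.symm (e x)) := by rwa [e.left_inv hx]
  have h3 : ContMDiffAt 𝓘(ℝ, F) 𝓘(ℝ, F) ∞ e' (f (e.symm (e x))) := by
    rw [e.left_inv hx]; exact contMDiffAt_of_mem_maximalAtlas he' hx'
  exact ContMDiffAt.comp (g := e') (f := f ∘ e.symm) (e x) h3 (h2.comp _ h1)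

theorem SmoothFormAt.congr {α η : DiffForm E M k} {x : M} (hα : SmoothFormAt α x)
    (h : ∀ᶠ y in 𝓝 x, η y = α y) : SmoothFormAt η x := by
  have h1 : inChart (chartAt E x) η =ᶠ[𝓝 (chartAt E x x)] inChart (chartAt E x) α := by
    have ht : Filter.Tendsto (chartAt E x).symm (𝓝 (chartAt E x x)) (𝓝 x) := by
      have := (chartAt E x).continuousAt_symm (mem_chart_target E x)
      rwa [ContinuousAt, (chartAt E x).left_inv (mem_chart_source E x)] at this
    filter_upwards [ht.eventually h] with y hy
    exact pullback_congr_form hy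
  exact ContDiffAt.congr_of_eventuallyEq hα h1

theorem inChart_refl (a : DiffForm E E k) : inChart (OpenPartialHomeomorph.refl E) a = a :=
  funext fun y => pullback_id_apply a y

/-- On a normed space, the exterior derivative is the usual one. -/
theorem extDer_eq_extDeriv (a : DiffForm E E k) (y : E) :
    extDer a y = extDeriv (𝕜 := ℝ) (E := E) (F := ℝ) a y := by
  unfold extDer
  simp only [chartAt_self_eq, inChart_refl]
  have : mfderiv 𝓘(ℝ, E) 𝓘(ℝ, E) (OpenPartialHomeomorph.refl E) y = ContinuousLinearMap.id ℝ E :=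
    mfderiv_id
  rw [this]
  rfl

theorem smoothFormAt_iff_contDiffAt {a : DiffForm E E k} {y : E} :
    SmoothFormAt a y ↔ ContDiffAt ℝ ∞ (F := E [⋀^Fin k]→L[ℝ] ℝ) a y := by
  unfold SmoothFormAt
  simp only [chartAt_self_eq, inChart_refl]
  rfl

variable [IsManifold 𝓘(ℝ, E) ∞ M] [IsManifold 𝓘(ℝ, F) ∞ N]

/-- Smoothness at a point can be checked in any chart. -/
theorem SmoothFormAt.contDiffAt_inChart {α : DiffForm E M k} {x : M} (h : SmoothFormAt α x)
    {e : OpenPartialHomeomorph M E} (he : e ∈ IsManifold.maximalAtlas 𝓘(ℝ, E) ∞ M)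
    (hx : x ∈ e.source) : ContDiffAt ℝ ∞ (inChart e α) (e x) := by
  have hc := IsManifold.chart_mem_maximalAtlas (I := 𝓘(ℝ, E)) (n := ∞) x
  have h1 := inChart_pullback_eventuallyEq (f := id) contMDiffAt_id he hx
    hc (mem_chart_source E x) α
  have h0 : pullback (E := E) id α = α := funext fun z => pullback_id_apply α z
  rw [h0] at h1
  refine ContDiffAt.congr_of_eventuallyEq ?_ h1
  refine ContDiffAt.compContinuousLinearMap_fderiv ?_
    (contDiffAt_chart_comp contMDiffAt_id he hx hc (mem_chart_source E x))
  have h1 : ((chartAt E x) ∘ id ∘ e.symm) (e x) = chartAt E x x := by simp [e.left_inv hx]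
  rw [h1]
  exact h

/-- Smoothness at a point does not depend on the chart, so the preferred charts alone detect it. -/
theorem isSmoothForm_iff {α : DiffForm E M k} : IsSmoothForm α ↔ ∀ x, SmoothFormAt α x := by
  constructor
  · intro h x
    exact (h _ (chart_mem_atlas E x)).contDiffAt
      ((chartAt E x).open_target.mem_nhds (mem_chart_target E x))
  · intro h e he y hy
    have := (h (e.symm y)).contDiffAt_inChart (IsManifold.subset_maximalAtlas he)
      (e.map_target hy)
    rw [e.right_inv hy] at this
    exact this.contDiffWithinAt

theorem SmoothFormAt.pullback {f : M → N} {x : M} {α : DiffForm F N k}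
    (h : SmoothFormAt α (f x)) (hf : ContMDiffAt 𝓘(ℝ, E) 𝓘(ℝ, F) ∞ f x) :
    SmoothFormAt (pullback (E := E) f α) x := by
  have hc := IsManifold.chart_mem_maximalAtlas (I := 𝓘(ℝ, E)) (n := ∞) x
  have hc' := IsManifold.chart_mem_maximalAtlas (I := 𝓘(ℝ, F)) (n := ∞) (f x)
  refine ContDiffAt.congr_of_eventuallyEq ?_ (inChart_pullback_eventuallyEq hf hc
    (mem_chart_source E x) hc' (mem_chart_source F (f x)) α)
  refine ContDiffAt.compContinuousLinearMap_fderiv ?_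
    (contDiffAt_chart_comp hf hc (mem_chart_source E x) hc' (mem_chart_source F (f x)))
  have h1 : ((chartAt F (f x)) ∘ f ∘ (chartAt E x).symm) (chartAt E x x) =
      chartAt F (f x) (f x) := by simp
  rw [h1]
  exact h

/-- The exterior derivative is natural. -/
theorem extDer_pullback {f : M → N} {x : M} {α : DiffForm F N k}
    (h : SmoothFormAt α (f x)) (hf : ContMDiffAt 𝓘(ℝ, E) 𝓘(ℝ, F) ∞ f x) :
    extDer (FoliatedForms.pullback (E := E) f α) x = FoliatedForms.pullback f (extDer α) x := by
  have hc := IsManifold.chart_mem_maximalAtlas (I := 𝓘(ℝ, E)) (n := ∞) x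
  have hc' := IsManifold.chart_mem_maximalAtlas (I := 𝓘(ℝ, F)) (n := ∞) (f x)
  have hx := mem_chart_source E x
  have hx' := mem_chart_source F (f x)
  set c := chartAt E x with hcdef
  set c' := chartAt F (f x) with hcdef'
  have hφ := contDiffAt_chart_comp hf hc hx hc' hx'
  have h1 : (c' ∘ f ∘ c.symm) (c x) = c' (f x) := by simp [c.left_inv hx]
  have hd : DifferentiableAt ℝ (inChart c' α) ((c' ∘ f ∘ c.symm) (c x)) := by
    rw [h1]; exact ContDiffAt.differentiableAt h (by simp)
  have h2 := (inChart_pullback_eventuallyEq hf hc hx hc' hx' α).extDeriv_eq.trans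
    (extDeriv_pullback hd hφ (by simpa using two_le_infty))
  have dc : MDifferentiableAt 𝓘(ℝ, E) 𝓘(ℝ, E) c x :=
    (contMDiffAt_of_mem_maximalAtlas hc hx).mdifferentiableAt (by simp)
  have dc' : MDifferentiableAt 𝓘(ℝ, F) 𝓘(ℝ, F) c' (f x) :=
    (contMDiffAt_of_mem_maximalAtlas hc' hx').mdifferentiableAt (by simp)
  have df : MDifferentiableAt 𝓘(ℝ, E) 𝓘(ℝ, F) f x := hf.mdifferentiableAt (by simp)
  have dφ : MDifferentiableAt 𝓘(ℝ, E) 𝓘(ℝ, F) (c' ∘ f ∘ c.symm) (c x) :=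
    (hφ.differentiableAt (by simp)).mdifferentiableAt
  have hev : (c' ∘ f ∘ c.symm) ∘ c =ᶠ[𝓝 x] c' ∘ f := by
    filter_upwards [c.open_source.mem_nhds hx] with z hz
    simp [c.left_inv hz]
  -- Two factorizations of the differential of `c' ∘ f`, through `c` and through `f`. Their equality
  -- carries the naturality of `extDeriv` from the charts to the manifolds.
  have hm : (mfderiv 𝓘(ℝ, E) 𝓘(ℝ, F) ((c' ∘ f ∘ c.symm) ∘ c) x : E →L[ℝ] F) =
    mfderiv 𝓘(ℝ, E) 𝓘(ℝ, F) (c' ∘ f) x := hev.mfderiv_eq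
  rw [mfderiv_comp x dφ dc, mfderiv_comp x dc' df, mfderiv_eq_fderiv] at hm
  have key : ∀ a : F [⋀^Fin (k + 1)]→L[ℝ] ℝ,
      (a.compContinuousLinearMap (fderiv ℝ (c' ∘ f ∘ c.symm) (c x))).compContinuousLinearMap
        (mfderiv 𝓘(ℝ, E) 𝓘(ℝ, E) c x : E →L[ℝ] E) =
      (a.compContinuousLinearMap
        (mfderiv 𝓘(ℝ, F) 𝓘(ℝ, F) c' (f x) : F →L[ℝ] F)).compContinuousLinearMap
        (mfderiv 𝓘(ℝ, E) 𝓘(ℝ, F) f x : E →L[ℝ] F) := by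
    intro a
    exact congrArg (fun L : E →L[ℝ] F => a.compContinuousLinearMap L) hm
  rw [h1] at h2
  unfold extDer
  rw [← hcdef, h2]
  exact key _

/-- In any chart, the exterior derivative is the usual one. -/
theorem inChart_extDer {α : DiffForm E M k} {e : OpenPartialHomeomorph M E}
    (he : e ∈ IsManifold.maximalAtlas 𝓘(ℝ, E) ∞ M) {y : E} (hy : y ∈ e.target)
    (h : SmoothFormAt α (e.symm y)) : inChart e (extDer α) y = extDeriv (inChart e α) y := by
  have := extDer_pullback (E := E) (f := e.symm) (x := y) h
    (contMDiffAt_symm_of_mem_maximalAtlas he hy)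
  rw [extDer_eq_extDeriv] at this
  exact this.symm

/-- In a chart, `d` is the derivative followed by a continuous linear map, the alternatization. -/
theorem IsSmoothForm.extDer {α : DiffForm E M k} (h : IsSmoothForm α) :
    IsSmoothForm (extDer α) := by
  intro e he
  have he' := IsManifold.subset_maximalAtlas (I := 𝓘(ℝ, E)) (n := ∞) he
  refine ContDiffOn.congr (f := extDeriv (inChart e α)) ?_
    fun y hy => inChart_extDer he' hy (isSmoothForm_iff.1 h _)
  intro y hy
  have h1 : ContDiffAt ℝ ∞ (inChart e α) y := (h e he).contDiffAt (e.open_target.mem_nhds hy)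
  have h2 : ContDiffAt ℝ ∞ (fderiv ℝ (inChart e α)) y := h1.fderiv_right (by simp)
  exact ((ContinuousAlternatingMap.alternatizeUncurryFinCLM ℝ E ℝ).contDiff.contDiffAt.comp y
    h2).contDiffWithinAt

theorem IsSmoothForm.extDer_extDer {α : DiffForm E M k} (h : IsSmoothForm α) :
    FoliatedForms.extDer (FoliatedForms.extDer α) = 0 := by
  funext x
  have hc := IsManifold.chart_mem_maximalAtlas (I := 𝓘(ℝ, E)) (n := ∞) x
  have hev : inChart (chartAt E x) (FoliatedForms.extDer α) =ᶠ[𝓝 (chartAt E x x)]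
      extDeriv (inChart (chartAt E x) α) := by
    filter_upwards [(chartAt E x).open_target.mem_nhds (mem_chart_target E x)] with y hy
    exact inChart_extDer hc hy (isSmoothForm_iff.1 h _)
  rw [FoliatedForms.extDer, hev.extDeriv_eq, extDeriv_extDeriv_apply (isSmoothForm_iff.1 h x)
    (by simpa using two_le_infty)]
  rfl

end Calculus

/-! ### The wedge product: linearity, norm bound, smoothness and pullback -/

section Wedge

variable {k l : ℕ}

section Algebra

variable {V : Type*} [AddCommGroup V] [Module ℝ V] {W : Type*} [AddCommGroup W] [Module ℝ W]

/-- The term of a permutation in the definition of the wedge product. -/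
def wedgeTerm (a : V [⋀^Fin k]→ₗ[ℝ] ℝ) (b : V [⋀^Fin l]→ₗ[ℝ] ℝ)
    (σ : Equiv.Perm (Fin k ⊕ Fin l)) (v : Fin (k + l) → V) : ℝ :=
  (Equiv.Perm.sign σ : ℤ) • (a (fun i => v (finSumFinEquiv (σ (Sum.inl i)))) *
    b (fun i => v (finSumFinEquiv (σ (Sum.inr i)))))

/-- With a chosen representative of every shuffle class, the product is an explicit finite sum, in
which linearity and compatibility with pullback can be read off term by term. -/
theorem wedgeAlg_apply (a : V [⋀^Fin k]→ₗ[ℝ] ℝ) (b : V [⋀^Fin l]→ₗ[ℝ] ℝ) (v : Fin (k + l) → V) :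
    wedgeAlg a b v =
      ∑ σ : Equiv.Perm.ModSumCongr (Fin k) (Fin l), wedgeTerm a b (Quotient.out σ) v := by
  have h : wedgeAlg a b v = ∑ σ : Equiv.Perm.ModSumCongr (Fin k) (Fin l), LinearMap.mul' ℝ ℝ
      (AlternatingMap.domCoprod.summand a b σ (v ∘ finSumFinEquiv)) := by
    simp [wedgeAlg, AlternatingMap.domCoprod, Function.comp_def]
  rw [h]
  refine Finset.sum_congr rfl fun σ _ => ?_
  have hσ : σ = Quotient.mk'' (Quotient.out σ) := (Quotient.out_eq σ).symm
  conv_lhs => rw [hσ]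
  rw [AlternatingMap.domCoprod.summand_mk'', smul_apply, Units.smul_def, map_zsmul]
  rfl

theorem wedgeAlg_compLinearMap (a : V [⋀^Fin k]→ₗ[ℝ] ℝ) (b : V [⋀^Fin l]→ₗ[ℝ] ℝ) (L : W →ₗ[ℝ] V) :
    wedgeAlg (a.compLinearMap L) (b.compLinearMap L) = (wedgeAlg a b).compLinearMap L := by
  ext v
  rw [AlternatingMap.compLinearMap_apply, wedgeAlg_apply, wedgeAlg_apply]
  rfl

theorem wedgeAlg_add_left (a a' : V [⋀^Fin k]→ₗ[ℝ] ℝ) (b : V [⋀^Fin l]→ₗ[ℝ] ℝ) :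
    wedgeAlg (a + a') b = wedgeAlg a b + wedgeAlg a' b := by
  ext v
  simp only [AlternatingMap.add_apply, wedgeAlg_apply, wedgeTerm, add_mul, smul_add,
    Finset.sum_add_distrib]

theorem wedgeAlg_add_right (a : V [⋀^Fin k]→ₗ[ℝ] ℝ) (b b' : V [⋀^Fin l]→ₗ[ℝ] ℝ) :
    wedgeAlg a (b + b') = wedgeAlg a b + wedgeAlg a b' := by
  ext v
  simp only [AlternatingMap.add_apply, wedgeAlg_apply, wedgeTerm, mul_add, smul_add,
    Finset.sum_add_distrib]

theorem wedgeAlg_smul_left (c : ℝ) (a : V [⋀^Fin k]→ₗ[ℝ] ℝ) (b : V [⋀^Fin l]→ₗ[ℝ] ℝ) :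
    wedgeAlg (c • a) b = c • wedgeAlg a b := by
  ext v
  change _ = c * wedgeAlg a b v
  rw [wedgeAlg_apply, wedgeAlg_apply, Finset.mul_sum]
  refine Finset.sum_congr rfl fun σ _ => ?_
  simp only [wedgeTerm, zsmul_eq_mul]
  change _ * ((c * a _) * b _) = _
  ring

theorem wedgeAlg_smul_right (c : ℝ) (a : V [⋀^Fin k]→ₗ[ℝ] ℝ) (b : V [⋀^Fin l]→ₗ[ℝ] ℝ) :
    wedgeAlg a (c • b) = c • wedgeAlg a b := by
  ext v
  change _ = c * wedgeAlg a b v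
  rw [wedgeAlg_apply, wedgeAlg_apply, Finset.mul_sum]
  refine Finset.sum_congr rfl fun σ _ => ?_
  simp only [wedgeTerm, zsmul_eq_mul]
  change _ * (a _ * (c * b _)) = _
  ring

end Algebra

variable {E : Type*} [NormedAddCommGroup E] [NormedSpace ℝ E]
  {F : Type*} [NormedAddCommGroup F] [NormedSpace ℝ F]
  {M : Type*} [TopologicalSpace M] [ChartedSpace E M]
  {N : Type*} [TopologicalSpace N] [ChartedSpace F N]

/-- The wedge product of continuous alternating forms. -/
def wedgeCont (a : E [⋀^Fin k]→L[ℝ] ℝ) (b : E [⋀^Fin l]→L[ℝ] ℝ) : E [⋀^Fin (k + l)]→L[ℝ] ℝ :=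
  { wedgeAlg a.toAlternatingMap b.toAlternatingMap with
    cont := continuous_wedgeAlg a b }

theorem wedgeCont_apply (a : E [⋀^Fin k]→L[ℝ] ℝ) (b : E [⋀^Fin l]→L[ℝ] ℝ) (v : Fin (k + l) → E) :
    wedgeCont a b v = wedgeAlg a.toAlternatingMap b.toAlternatingMap v := rfl

/-- Each shuffle distributes the vectors between the two factors, so its term is bounded by the
product of the norms; the constant counts the shuffles. -/
theorem norm_wedgeCont_le (a : E [⋀^Fin k]→L[ℝ] ℝ) (b : E [⋀^Fin l]→L[ℝ] ℝ) :
    ‖wedgeCont a b‖ ≤ Fintype.card (Equiv.Perm.ModSumCongr (Fin k) (Fin l)) * ‖a‖ * ‖b‖ := by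
  refine ContinuousAlternatingMap.opNorm_le_bound _ (by positivity) fun v => ?_
  have h : ∀ σ : Equiv.Perm (Fin k ⊕ Fin l),
      ‖wedgeTerm a.toAlternatingMap b.toAlternatingMap σ v‖ ≤ ‖a‖ * ‖b‖ * ∏ i, ‖v i‖ := by
    intro σ
    have h1 : ‖wedgeTerm a.toAlternatingMap b.toAlternatingMap σ v‖ =
        ‖a (fun i => v (finSumFinEquiv (σ (Sum.inl i))))‖ *
          ‖b (fun i => v (finSumFinEquiv (σ (Sum.inr i))))‖ := by
      rw [← norm_mul]
      unfold wedgeTerm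
      rcases Int.units_eq_one_or (Equiv.Perm.sign σ) with h | h <;> rw [h] <;> simp
    have h2 : ∏ i, ‖v i‖ = (∏ i, ‖v (finSumFinEquiv (σ (Sum.inl i)))‖) *
        ∏ i, ‖v (finSumFinEquiv (σ (Sum.inr i)))‖ := by
      rw [← Fintype.prod_sum_type (fun c => ‖v (finSumFinEquiv (σ c))‖)]
      exact ((Equiv.prod_comp (σ.trans finSumFinEquiv) (fun i => ‖v i‖))).symm
    rw [h1, h2, mul_mul_mul_comm]
    exact mul_le_mul (a.le_opNorm _) (b.le_opNorm _) (norm_nonneg _) (by positivity)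
  rw [wedgeCont_apply, wedgeAlg_apply]
  refine (norm_sum_le_of_le _ fun σ _ => h _).trans_eq ?_
  simp [Finset.card_univ, mul_assoc]

/-- The wedge product as a continuous bilinear map. -/
def wedgeCLM (E : Type*) [NormedAddCommGroup E] [NormedSpace ℝ E] (k l : ℕ) :
    (E [⋀^Fin k]→L[ℝ] ℝ) →L[ℝ] (E [⋀^Fin l]→L[ℝ] ℝ) →L[ℝ] E [⋀^Fin (k + l)]→L[ℝ] ℝ :=
  LinearMap.mkContinuous₂
    (LinearMap.mk₂ ℝ wedgeCont
      (fun a a' b => by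
        ext v
        exact DFunLike.congr_fun
          (wedgeAlg_add_left a.toAlternatingMap a'.toAlternatingMap b.toAlternatingMap) v)
      (fun c a b => by
        ext v
        exact DFunLike.congr_fun (wedgeAlg_smul_left c a.toAlternatingMap b.toAlternatingMap) v)
      (fun a b b' => by
        ext v
        exact DFunLike.congr_fun
          (wedgeAlg_add_right a.toAlternatingMap b.toAlternatingMap b'.toAlternatingMap) v)
      (fun c a b => by
        ext v
        exact DFunLike.congr_fun (wedgeAlg_smul_right c a.toAlternatingMap b.toAlternatingMap) v))
    (Fintype.card (Equiv.Perm.ModSumCongr (Fin k) (Fin l))) norm_wedgeCont_le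

theorem pullback_wedge (f : M → N) (α : DiffForm F N k) (η : DiffForm F N l) :
    pullback (E := E) f (wedge α η) = wedge (pullback f α) (pullback f η) := by
  funext x
  ext v
  exact (DFunLike.congr_fun (wedgeAlg_compLinearMap (α (f x)).toAlternatingMap
    (η (f x)).toAlternatingMap (mfderiv 𝓘(ℝ, E) 𝓘(ℝ, F) f x).toLinearMap) v).symm

theorem IsSmoothForm.wedge {α : DiffForm E M k} {η : DiffForm E M l} (hα : IsSmoothForm α)
    (hη : IsSmoothForm η) : IsSmoothForm (wedge α η) := by
  intro e he
  have h : inChart e (FoliatedForms.wedge α η) =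
      fun y => wedgeCLM E k l (inChart e α y) (inChart e η y) := by
    funext y
    exact congrFun (pullback_wedge (E := E) e.symm α η) y
  rw [h]
  exact ((wedgeCLM E k l).contDiff.comp_contDiffOn (hα e he)).clm_apply (hη e he)

theorem pullback_oneForm (f : M → N) :
    pullback (E := E) f (oneForm : DiffForm F N 0) = oneForm := by
  funext x
  ext v
  rfl

theorem isSmoothForm_oneForm : IsSmoothForm (oneForm : DiffForm E M 0) := by
  intro e _
  have h : inChart e (oneForm : DiffForm E M 0) =
      fun _ => ContinuousAlternatingMap.constOfIsEmpty ℝ E (Fin 0) 1 := by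
    funext y
    exact congrFun (pullback_oneForm (E := E) (M := E) e.symm) y
  rw [h]
  exact contDiffOn_const

end Wedge

/-! ### Vectors annihilating an alternating form -/

section Kills

variable {k : ℕ} {V : Type*} [AddCommGroup V] [Module ℝ V] [TopologicalSpace V]
  {W : Type*} [AddCommGroup W] [Module ℝ W] [TopologicalSpace W]

/-- The contraction of the alternating form `a` with `v` vanishes. -/
def Kills (a : V [⋀^Fin k]→L[ℝ] ℝ) (v : V) : Prop := ∀ w : Fin k → V, (∃ i, w i = v) → a w = 0

theorem Kills.compContinuousLinearMap {a : W [⋀^Fin k]→L[ℝ] ℝ} {L : V →L[ℝ] W} {v : V}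
    (h : Kills a (L v)) : Kills (a.compContinuousLinearMap L) v := by
  rintro w ⟨i, hi⟩
  exact h _ ⟨i, by simp [hi]⟩

theorem kills_zero (a : V [⋀^Fin k]→L[ℝ] ℝ) : Kills a 0 := by
  rintro w ⟨i, hi⟩
  exact a.map_coord_zero i hi

/-- An entry can be moved to the first slot at the cost of a sign. -/
theorem kills_iff_cons {a : V [⋀^Fin (k + 1)]→L[ℝ] ℝ} {v : V} :
    Kills a v ↔ ∀ w : Fin k → V, a (Matrix.vecCons v w) = 0 := by
  constructor
  · intro h w
    exact h _ ⟨0, rfl⟩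
  · rintro h w ⟨i, rfl⟩
    have := a.toAlternatingMap.map_insertNth i (w i) (i.removeNth w)
    rw [Fin.insertNth_self_removeNth] at this
    change a w = _ • a _ at this
    rw [this, h, smul_zero]

/-- The arguments are exchanged one slot at a time: each exchange changes the value by a term with
an annihilated argument. -/
theorem eq_of_kills_sub {a : V [⋀^Fin k]→L[ℝ] ℝ} {v w : Fin k → V}
    (h : ∀ i, Kills a (v i - w i)) : a v = a w := by
  classical
  have key : ∀ s : Finset (Fin k), a (s.piecewise v w) = a w := by
    intro s
    induction s using Finset.induction_on with
    | empty => simp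
    | insert i s hi ih =>
      have h1 : (s.piecewise v w) = Function.update (s.piecewise v w) i (w i) := by
        rw [eq_comm, Function.update_eq_self_iff]
        simp [hi]
      have h2 := a.toAlternatingMap.map_update_sub (s.piecewise v w) i (v i) (w i)
      have h3 := h i (Function.update (s.piecewise v w) i (v i - w i)) ⟨i, by simp⟩
      change a _ = a _ - a _ at h2
      rw [h3] at h2
      rw [Finset.piecewise_insert, sub_eq_zero.1 h2.symm, ← h1, ih]
  simpa using key Finset.univ

end Kills

/-! ### Calculus on normed spaces: constancy along fibres, smooth local inverses -/

section Flat

variable {k : ℕ} {E : Type*} [NormedAddCommGroup E] [NormedSpace ℝ E]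
  {F : Type*} [NormedAddCommGroup F] [NormedSpace ℝ F]
  {K : Type*} [NormedAddCommGroup K] [NormedSpace ℝ K]
  {V : Type*} [NormedAddCommGroup V] [NormedSpace ℝ V]

/-- If `ι_v θ = 0` near `y` and `ι_v dθ = 0` at `y`, then the directional derivative of `θ` in the
direction `v` vanishes at `y`. -/
theorem fderiv_apply_eq_zero_of_kills {θ : E → E [⋀^Fin k]→L[ℝ] ℝ} {y v : E}
    (hθ : DifferentiableAt ℝ θ y) (h : ∀ᶠ z in 𝓝 y, Kills (θ z) v)
    (hd : Kills (extDeriv θ y) v) : fderiv ℝ θ y v = 0 := by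
  ext w
  -- In the formula for `dθ` on `v, w₁, …, w_k`, the first term is the derivative of `θ(w)` along
  -- `v`; all the others keep `v` as an argument of `θ`.
  have h1 := hd (Matrix.vecCons v w) ⟨0, rfl⟩
  rw [extDeriv_apply hθ, Fin.sum_univ_succ] at h1
  have h2 : ∀ j : Fin k, (-1 : ℤ) ^ (j.succ : Fin (k + 1)).val • fderiv ℝ
      (θ · (j.succ.removeNth (Matrix.vecCons v w))) y (Matrix.vecCons v w j.succ) = 0 := by
    intro j
    have hz : (fun z => θ z (j.succ.removeNth (Matrix.vecCons v w))) =ᶠ[𝓝 y] fun _ => 0 := by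
      filter_upwards [h] with z hz
      -- Since `Fin k` contains `j`, the degree is positive, so after the removal of slot `j.succ`
      -- there is a slot `0`, and it holds `v`.
      obtain ⟨m, rfl⟩ : ∃ m, k = m + 1 := ⟨k - 1, by have := j.2; omega⟩
      exact hz _ ⟨0, by simp [Fin.removeNth]⟩
    rw [hz.fderiv_eq]
    simp
  rw [Finset.sum_eq_zero fun j _ => h2 j, add_zero] at h1
  have h3 : fderiv ℝ (fun z => θ z w) y v = (fderiv ℝ θ y v) w := by
    have := (ContinuousAlternatingMap.apply ℝ E ℝ w).hasFDerivAt.comp y hθ.hasFDerivAt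
    exact congrArg (fun L : E →L[ℝ] ℝ => L v) this.fderiv
  have h4 : (0 : Fin (k + 1)).removeNth (Matrix.vecCons v w) = w := by
    funext i; simp [Fin.removeNth]
  rw [← h3]
  simpa [h4] using h1

/-- A function on a product of balls whose derivative in the direction of the second factor
vanishes does not depend on the second variable. -/
theorem eq_of_fderiv_snd_eq_zero {h : F × K → V} {q : F × K} {r : ℝ}
    (hd : ∀ y ∈ Metric.ball q r, DifferentiableAt ℝ h y)
    (h0 : ∀ y ∈ Metric.ball q r, ∀ u : K, fderiv ℝ h y (0, u) = 0) {y : F × K}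
    (hy : y ∈ Metric.ball q r) : h y = h (y.1, q.2) := by
  have hball : Metric.ball q r = Metric.ball q.1 r ×ˢ Metric.ball q.2 r := by
    rw [ball_prod_same]
  rw [hball] at hy
  have hmem : ∀ t ∈ Metric.ball q.2 r, (y.1, t) ∈ Metric.ball q r := by
    intro t ht
    rw [hball]
    exact ⟨hy.1, ht⟩
  have hder : ∀ t ∈ Metric.ball q.2 r, HasFDerivAt (fun t => h (y.1, t)) (0 : K →L[ℝ] V) t := by
    intro t ht
    have h1 := (hd _ (hmem t ht)).hasFDerivAt.comp t (hasFDerivAt_prodMk_right y.1 t)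
    have h2 : (fderiv ℝ h (y.1, t)).comp (ContinuousLinearMap.inr ℝ F K) = 0 := by
      ext u
      exact h0 _ (hmem t ht) u
    rwa [h2] at h1
  have hr : 0 < r := Metric.pos_of_mem_ball hy.2
  exact (convex_ball q.2 r).is_const_of_fderivWithin_eq_zero (𝕜 := ℝ) (f := fun t => h (y.1, t))
    (fun t ht => (hder t ht).differentiableAt.differentiableWithinAt)
    (fun t ht => by
      rw [fderivWithin_of_isOpen Metric.isOpen_ball ht, (hder t ht).fderiv])
    hy.2 (Metric.mem_ball_self hr)

/-- The inverse function theorem, for a smooth map on an open set. -/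
theorem exists_smooth_inverse [CompleteSpace E] {Φ : E → F} {O : Set E} (hO : IsOpen O)
    (hΦ : ContDiffOn ℝ ∞ Φ O) {a : E} (ha : a ∈ O) (h : (fderiv ℝ Φ a).IsInvertible) :
    ∃ Ψ : OpenPartialHomeomorph E F, a ∈ Ψ.source ∧ Ψ.source ⊆ O ∧ (Ψ : E → F) = Φ ∧
      ContDiffOn ℝ ∞ Ψ.symm Ψ.target := by
  obtain ⟨L, hL⟩ := h
  have hc : ContDiffAt ℝ ∞ Φ a := hΦ.contDiffAt (hO.mem_nhds ha)
  have hd : HasFDerivAt Φ (L : E →L[ℝ] F) a := by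
    rw [hL]; exact (hc.differentiableAt (by simp)).hasFDerivAt
  set Ψ₀ := hc.toOpenPartialHomeomorph Φ hd (by simp) with hΨ₀
  have hcont : ContinuousOn (fderiv ℝ Φ) O := hΦ.continuousOn_fderiv_of_isOpen hO (by simp)
  -- Invertibility at `a` alone gives smoothness of the inverse at one point; restricting to the
  -- open set where the derivative is invertible gives it on the whole target.
  have hopen : IsOpen (O ∩ fderiv ℝ Φ ⁻¹' (range ((↑) : (E ≃L[ℝ] F) → E →L[ℝ] F))) :=
    hcont.isOpen_inter_preimage hO ContinuousLinearEquiv.isOpen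
  refine ⟨Ψ₀.restrOpen _ hopen, ?_, ?_, rfl, ?_⟩
  · exact ⟨hc.mem_toOpenPartialHomeomorph_source hd (by simp), ha, L, hL⟩
  · rintro y ⟨-, hy, -⟩
    exact hy
  · intro z hz
    have hz' := (Ψ₀.restrOpen _ hopen).map_target hz
    obtain ⟨-, hz1, L', hL'⟩ := hz'
    have hzt : z ∈ Ψ₀.target := by
      have := hz.1
      exact this
    have hc' : ContDiffAt ℝ ∞ Φ (Ψ₀.symm z) := hΦ.contDiffAt (hO.mem_nhds hz1)
    refine (Ψ₀.contDiffAt_symm hzt (f₀' := L') ?_ hc').contDiffWithinAt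
    rw [hL']
    exact (hc'.differentiableAt (by simp)).hasFDerivAt

end Flat

/-! ### Straightening a submersion -/

section Descent

variable {E : Type*} [NormedAddCommGroup E] [NormedSpace ℝ E]
  {F : Type*} [NormedAddCommGroup F] [NormedSpace ℝ F]
  {V : Type*} [NormedAddCommGroup V] [NormedSpace ℝ V]
  {M : Type*} [TopologicalSpace M] [ChartedSpace E M] [IsManifold 𝓘(ℝ, E) ∞ M] {k : ℕ}

/-- The differential of a map, computed in the preferred chart. -/
theorem mfderiv_eq_fderiv_comp_chart {f : M → F} {x x₀ : M} (hx : x ∈ (chartAt E x₀).source)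
    (hf : ContMDiffAt 𝓘(ℝ, E) 𝓘(ℝ, F) ∞ f x) :
    (mfderiv 𝓘(ℝ, E) 𝓘(ℝ, F) f x : E →L[ℝ] F) =
      (fderiv ℝ (f ∘ (chartAt E x₀).symm) (chartAt E x₀ x)).comp
        (mfderiv 𝓘(ℝ, E) 𝓘(ℝ, E) (chartAt E x₀) x : E →L[ℝ] E) := by
  set c := chartAt E x₀
  have hc := IsManifold.chart_mem_maximalAtlas (I := 𝓘(ℝ, E)) (n := ∞) x₀
  have dc : MDifferentiableAt 𝓘(ℝ, E) 𝓘(ℝ, E) c x :=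
    (contMDiffAt_of_mem_maximalAtlas hc hx).mdifferentiableAt (by simp)
  have dc' : MDifferentiableAt 𝓘(ℝ, E) 𝓘(ℝ, E) c.symm (c x) :=
    (contMDiffAt_symm_of_mem_maximalAtlas hc (c.map_source hx)).mdifferentiableAt (by simp)
  have df : MDifferentiableAt 𝓘(ℝ, E) 𝓘(ℝ, F) f (c.symm (c x)) := by
    rw [c.left_inv hx]; exact hf.mdifferentiableAt (by simp)
  have hev : f =ᶠ[𝓝 x] (f ∘ c.symm) ∘ c := by
    filter_upwards [c.open_source.mem_nhds hx] with z hz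
    simp [c.left_inv hz]
  have h1 : (mfderiv 𝓘(ℝ, E) 𝓘(ℝ, F) f x : E →L[ℝ] F) =
    mfderiv 𝓘(ℝ, E) 𝓘(ℝ, F) ((f ∘ c.symm) ∘ c) x := hev.mfderiv_eq
  rw [h1, mfderiv_comp x (df.comp (c x) dc') dc, mfderiv_eq_fderiv]
  rfl

theorem isInvertible_mfderiv_chart {x x₀ : M} (hx : x ∈ (chartAt E x₀).source) :
    (mfderiv 𝓘(ℝ, E) 𝓘(ℝ, E) (chartAt E x₀) x).IsInvertible := by
  have : IsManifold 𝓘(ℝ, E) 1 M := IsManifold.of_le one_le_infty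
  exact isInvertible_mfderiv_extChartAt (I := 𝓘(ℝ, E)) (x := x₀) (y := x) (by simpa using hx)

/-- The expression of a map in the preferred chart is smooth where the map is. -/
theorem contDiffOn_comp_chart_symm {f : M → F} {x₀ : M} {U : Set M}
    (hf : ∀ x ∈ U, ContMDiffAt 𝓘(ℝ, E) 𝓘(ℝ, F) ∞ f x) :
    ContDiffOn ℝ ∞ (f ∘ (chartAt E x₀).symm)
      ((chartAt E x₀).target ∩ (chartAt E x₀).symm ⁻¹' U) := by
  rintro y ⟨hy, hyU⟩
  have hc := IsManifold.chart_mem_maximalAtlas (I := 𝓘(ℝ, E)) (n := ∞) x₀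
  have := (hf _ hyU).comp y (contMDiffAt_symm_of_mem_maximalAtlas hc hy)
  exact (contMDiffAt_iff_contDiffAt.1 this).contDiffWithinAt

/-- A submersion is, near every point, the projection of a product of balls. -/
theorem exists_straightening [CompleteSpace E] [FiniteDimensional ℝ F] {f : M → F} {U : Set M}
    (hU : IsOpen U) (hf : ∀ x ∈ U, ContMDiffAt 𝓘(ℝ, E) 𝓘(ℝ, F) ∞ f x) {x₀ : M} (hx₀ : x₀ ∈ U)
    (hs : Function.Surjective (mfderiv 𝓘(ℝ, E) 𝓘(ℝ, F) f x₀)) :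
    ∃ (K : Submodule ℝ E) (Θ : OpenPartialHomeomorph M (F × K)) (r : ℝ),
      x₀ ∈ Θ.source ∧ Θ.source ⊆ U ∧ Θ.target = Metric.ball (Θ x₀) r ∧
      ContMDiffOn 𝓘(ℝ, E) 𝓘(ℝ, F × K) ∞ Θ Θ.source ∧
      ContMDiffOn 𝓘(ℝ, F × K) 𝓘(ℝ, E) ∞ Θ.symm Θ.target ∧
      ∀ x ∈ Θ.source, (Θ x).1 = f x := by
  set c := chartAt E x₀ with hcdef
  have hc := IsManifold.chart_mem_maximalAtlas (I := 𝓘(ℝ, E)) (n := ∞) x₀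
  have hx : x₀ ∈ c.source := mem_chart_source E x₀
  set g := f ∘ c.symm with hg
  set O := c.target ∩ c.symm ⁻¹' U with hO
  have hOopen : IsOpen O := c.isOpen_inter_preimage_symm hU
  have haO : c x₀ ∈ O := ⟨c.map_source hx, by simpa [c.left_inv hx] using hx₀⟩
  have hgs : ContDiffOn ℝ ∞ g O := contDiffOn_comp_chart_symm hf
  set f' := fderiv ℝ g (c x₀) with hf'
  have hsurj : f'.range = ⊤ := by
    rw [LinearMap.range_eq_top]
    intro w
    obtain ⟨v, hv⟩ := hs w
    have := mfderiv_eq_fderiv_comp_chart hx (hf x₀ hx₀)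
    refine ⟨mfderiv 𝓘(ℝ, E) 𝓘(ℝ, E) c x₀ v, ?_⟩
    rw [← hv]
    exact (congrArg (fun L : E →L[ℝ] F => L v) this).symm
  -- The range of `f'` is finite-dimensional, so its kernel has a continuous projection `π`;
  -- completing `g` by `π` makes the derivative invertible.
  obtain ⟨π, hπ⟩ := f'.ker_closedComplemented_of_finiteDimensional_range
  set Φ : E → F × f'.ker := fun y => (g y, π y) with hΦ
  have hΦs : ContDiffOn ℝ ∞ Φ O := hgs.prodMk π.contDiff.contDiffOn
  have hga : HasFDerivAt g f' (c x₀) :=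
    ((hgs.contDiffAt (hOopen.mem_nhds haO)).differentiableAt (by simp)).hasFDerivAt
  have hΦ' : HasFDerivAt Φ (f'.prod π) (c x₀) := hga.prodMk π.hasFDerivAt
  have hinv : (fderiv ℝ Φ (c x₀)).IsInvertible := by
    rw [hΦ'.fderiv]
    have : CompleteSpace f'.ker := f'.isClosed_ker.completeSpace_coe
    exact ⟨ContinuousLinearMap.equivProdOfSurjectiveOfIsCompl f' π hsurj
      (LinearMap.range_eq_of_proj hπ) (LinearMap.isCompl_of_proj hπ), rfl⟩
  obtain ⟨Ψ, haΨ, hΨO, hΨ, hΨs⟩ := exists_smooth_inverse hOopen hΦs haO hinv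
  set Θ₀ := c.trans Ψ with hΘ₀
  have hx0' : x₀ ∈ Θ₀.source := by
    rw [hΘ₀, OpenPartialHomeomorph.trans_source]
    exact ⟨hx, haΨ⟩
  -- A ball for the maximum norm of `F × K` is a product of balls, so its vertical slices are
  -- convex. The restriction is made on the inverse because the condition concerns the target.
  obtain ⟨r, hr, hball⟩ := Metric.isOpen_iff.1 Θ₀.open_target _ (Θ₀.map_source hx0')
  set Θ := (Θ₀.symm.restrOpen (Metric.ball (Θ₀ x₀) r) Metric.isOpen_ball).symm with hΘ
  have htarget : Θ.target = Metric.ball (Θ₀ x₀) r := by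
    change Θ₀.target ∩ Metric.ball (Θ₀ x₀) r = _
    exact inter_eq_right.2 hball
  have hsource : Θ.source ⊆ Θ₀.source := by
    intro y hy
    have h1 := Θ.map_source hy
    rw [htarget] at h1
    have h2 := Θ.left_inv hy
    rw [← h2]
    exact Θ₀.map_target (hball h1)
  have hcoe : ∀ x, Θ x = Φ (c x) := fun x => by
    change Ψ (c x) = _
    rw [hΨ]
  have hsub : ∀ x ∈ Θ.source, x ∈ c.source ∧ c x ∈ Ψ.source := by
    intro x hx
    have := hsource hx
    rw [hΘ₀, OpenPartialHomeomorph.trans_source] at this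
    exact this
  refine ⟨f'.ker, Θ, r, ?_, ?_, htarget, ?_, ?_, ?_⟩
  · have h1 : Θ₀ x₀ ∈ Θ.target := by rw [htarget]; exact Metric.mem_ball_self hr
    have h2 := Θ.map_target h1
    have h3 : Θ.symm (Θ₀ x₀) = x₀ := Θ₀.left_inv hx0'
    rwa [h3] at h2
  · intro x hx
    have := (hΨO (hsub x hx).2).2
    rwa [mem_preimage, c.left_inv (hsub x hx).1] at this
  · intro x hx
    have h1 : ContMDiffAt 𝓘(ℝ, E) 𝓘(ℝ, E) ∞ c x := contMDiffAt_of_mem_maximalAtlas hc (hsub x hx).1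
    have h2 : ContMDiffAt 𝓘(ℝ, E) 𝓘(ℝ, F × f'.ker) ∞ Φ (c x) :=
      (hΦs.contDiffAt (hOopen.mem_nhds (hΨO (hsub x hx).2))).contMDiffAt
    have h3 : (Θ : M → F × f'.ker) = Φ ∘ c := funext hcoe
    rw [h3]
    exact (h2.comp x h1).contMDiffWithinAt
  · intro z hz
    have hz0 : z ∈ Θ₀.target := by rw [htarget] at hz; exact hball hz
    rw [hΘ₀, OpenPartialHomeomorph.trans_target] at hz0
    have h1 : ContMDiffAt 𝓘(ℝ, F × f'.ker) 𝓘(ℝ, E) ∞ Ψ.symm z :=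
      (hΨs.contDiffAt (Ψ.open_target.mem_nhds hz0.1)).contMDiffAt
    have h2 : ContMDiffAt 𝓘(ℝ, E) 𝓘(ℝ, E) ∞ c.symm (Ψ.symm z) :=
      contMDiffAt_symm_of_mem_maximalAtlas hc hz0.2
    exact (h2.comp z h1).contMDiffWithinAt
  · intro x hx
    rw [hcoe]
    change f (c.symm (c x)) = f x
    rw [c.left_inv (hsub x hx).1]

end Descent

/-! ### Descent of functions and forms along a submersion -/

section LocalDescent

/-- The derivatives of the inverse of a straightening in the directions of the second factor are
tangent to the fibres. -/
theorem mfderiv_straightening_symm {E : Type*} [NormedAddCommGroup E] [NormedSpace ℝ E]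
    {F : Type*} [NormedAddCommGroup F] [NormedSpace ℝ F]
    {M : Type*} [TopologicalSpace M] [ChartedSpace E M] {f : M → F}
    {K : Submodule ℝ E} {Θ : OpenPartialHomeomorph M (F × K)}
    (hΘs : ContMDiffOn 𝓘(ℝ, F × K) 𝓘(ℝ, E) ∞ Θ.symm Θ.target) (hfst : ∀ x ∈ Θ.source, (Θ x).1 = f x)
    (hf : ∀ x ∈ Θ.source, ContMDiffAt 𝓘(ℝ, E) 𝓘(ℝ, F) ∞ f x) {z : F × K} (hz : z ∈ Θ.target)
    (u : F × K) :
    mfderiv 𝓘(ℝ, E) 𝓘(ℝ, F) f (Θ.symm z) (mfderiv 𝓘(ℝ, F × K) 𝓘(ℝ, E) Θ.symm z u) = u.1 := by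
  have d1 : MDifferentiableAt 𝓘(ℝ, F × K) 𝓘(ℝ, E) Θ.symm z :=
    (hΘs.contMDiffAt (Θ.open_target.mem_nhds hz)).mdifferentiableAt (by simp)
  have d2 : MDifferentiableAt 𝓘(ℝ, E) 𝓘(ℝ, F) f (Θ.symm z) :=
    (hf _ (Θ.map_target hz)).mdifferentiableAt (by simp)
  have hev : f ∘ Θ.symm =ᶠ[𝓝 z] (Prod.fst : F × K → F) := by
    filter_upwards [Θ.open_target.mem_nhds hz] with w hw
    have := hfst _ (Θ.map_target hw)
    rw [Θ.right_inv hw] at this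
    exact this.symm
  have h1 : (mfderiv 𝓘(ℝ, F × K) 𝓘(ℝ, F) (f ∘ Θ.symm) z : F × K →L[ℝ] F) =
      mfderiv 𝓘(ℝ, F × K) 𝓘(ℝ, F) (Prod.fst : F × K → F) z := hev.mfderiv_eq
  rw [mfderiv_comp z d2 d1, mfderiv_eq_fderiv, fderiv_fst] at h1
  exact congrArg (fun L : F × K →L[ℝ] F => L u) h1

variable {E : Type*} [NormedAddCommGroup E] [NormedSpace ℝ E] [CompleteSpace E]
  {F : Type*} [NormedAddCommGroup F] [NormedSpace ℝ F] [FiniteDimensional ℝ F]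
  {V : Type*} [NormedAddCommGroup V] [NormedSpace ℝ V]
  {M : Type*} [TopologicalSpace M] [ChartedSpace E M] [IsManifold 𝓘(ℝ, E) ∞ M] {k : ℕ}
  {f : M → F} {U : Set M} {x₀ : M}

/-- In a straightening, `f` is the first projection of a product, which is an open map. -/
theorem map_nhds_eq_of_submersion (hU : IsOpen U)
    (hf : ∀ x ∈ U, ContMDiffAt 𝓘(ℝ, E) 𝓘(ℝ, F) ∞ f x) (hx₀ : x₀ ∈ U)
    (hs : Function.Surjective (mfderiv 𝓘(ℝ, E) 𝓘(ℝ, F) f x₀)) :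
    Filter.map f (𝓝 x₀) = 𝓝 (f x₀) := by
  obtain ⟨K, Θ, r, hx, -, -, -, -, hfst⟩ := exists_straightening hU hf hx₀ hs
  have h1 : f =ᶠ[𝓝 x₀] Prod.fst ∘ Θ := by
    filter_upwards [Θ.open_source.mem_nhds hx] with z hz
    exact (hfst z hz).symm
  rw [Filter.map_congr h1, ← Filter.map_map, Θ.map_nhds_eq hx, map_fst_nhds, hfst x₀ hx]

/-- A function whose differential vanishes on the vectors tangent to the fibres of a submersion
factors locally through the submersion. -/
theorem exists_local_factor (hU : IsOpen U)
    (hf : ∀ x ∈ U, ContMDiffAt 𝓘(ℝ, E) 𝓘(ℝ, F) ∞ f x) (hx₀ : x₀ ∈ U)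
    (hs : Function.Surjective (mfderiv 𝓘(ℝ, E) 𝓘(ℝ, F) f x₀)) {g : M → V}
    (hg : ∀ x ∈ U, ContMDiffAt 𝓘(ℝ, E) 𝓘(ℝ, V) ∞ g x)
    (hker : ∀ x ∈ U, ∀ v, mfderiv 𝓘(ℝ, E) 𝓘(ℝ, F) f x v = 0 →
      mfderiv 𝓘(ℝ, E) 𝓘(ℝ, V) g x v = 0) :
    ∃ h : F → V, (∀ᶠ y in 𝓝 (f x₀), ContDiffAt ℝ ∞ h y) ∧ ∀ᶠ x in 𝓝 x₀, g x = h (f x) := by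
  obtain ⟨K, Θ, r, hx, hsub, htar, -, hΘs, hfst⟩ := exists_straightening hU hf hx₀ hs
  have hG : ∀ z ∈ Θ.target, ContDiffAt ℝ ∞ (g ∘ Θ.symm) z := by
    intro z hz
    rw [← contMDiffAt_iff_contDiffAt]
    exact (hg _ (hsub (Θ.map_target hz))).comp z (hΘs.contMDiffAt (Θ.open_target.mem_nhds hz))
  have hG0 : ∀ z ∈ Θ.target, ∀ u : K, fderiv ℝ (g ∘ Θ.symm) z (0, u) = 0 := by
    intro z hz u
    have d1 : MDifferentiableAt 𝓘(ℝ, F × K) 𝓘(ℝ, E) Θ.symm z :=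
      (hΘs.contMDiffAt (Θ.open_target.mem_nhds hz)).mdifferentiableAt (by simp)
    have d2 : MDifferentiableAt 𝓘(ℝ, E) 𝓘(ℝ, V) g (Θ.symm z) :=
      (hg _ (hsub (Θ.map_target hz))).mdifferentiableAt (by simp)
    rw [← mfderiv_eq_fderiv, mfderiv_comp z d2 d1]
    exact hker _ (hsub (Θ.map_target hz)) _
      (mfderiv_straightening_symm hΘs hfst (fun x hx => hf x (hsub hx)) hz (0, u))
  have hmem : Θ x₀ ∈ Θ.target := Θ.map_source hx
  have hr : 0 < r := by rw [htar] at hmem; exact Metric.pos_of_mem_ball hmem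
  -- The factor is the restriction of `g` to the horizontal slice through `x₀`.
  refine ⟨fun y => g (Θ.symm (y, (Θ x₀).2)), ?_, ?_⟩
  · rw [← hfst x₀ hx]
    filter_upwards [Metric.ball_mem_nhds _ hr] with y hy
    have hy' : (y, (Θ x₀).2) ∈ Θ.target := by
      rw [htar, ← ball_prod_same]
      exact ⟨hy, Metric.mem_ball_self hr⟩
    exact ContDiffAt.comp (g := g ∘ Θ.symm) y (hG _ hy') (contDiffAt_id.prodMk contDiffAt_const)
  · filter_upwards [Θ.open_source.mem_nhds hx] with x hxs
    have h1 := Θ.map_source hxs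
    rw [htar] at hG hG0 h1
    have := eq_of_fderiv_snd_eq_zero (fun y hy => (hG y hy).differentiableAt (by simp)) hG0 h1
    simp only [Function.comp, Θ.left_inv hxs, hfst x hxs] at this
    exact this

/-- A form `ξ` such that the contractions of `ξ` and `dξ` with the vectors tangent to the fibres of
a submersion vanish is locally a pullback by the submersion. -/
theorem exists_local_descent (hU : IsOpen U)
    (hf : ∀ x ∈ U, ContMDiffAt 𝓘(ℝ, E) 𝓘(ℝ, F) ∞ f x) (hx₀ : x₀ ∈ U)
    (hs : Function.Surjective (mfderiv 𝓘(ℝ, E) 𝓘(ℝ, F) f x₀)) {ξ : DiffForm E M k}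
    (hξ : ∀ x ∈ U, SmoothFormAt ξ x)
    (hker : ∀ x ∈ U, ∀ v, mfderiv 𝓘(ℝ, E) 𝓘(ℝ, F) f x v = 0 →
      Kills (ξ x) v ∧ Kills (extDer ξ x) v) :
    ∃ b : DiffForm F F k, (∀ᶠ y in 𝓝 (f x₀), SmoothFormAt b y) ∧
      ∀ᶠ x in 𝓝 x₀, ξ x = pullback f b x := by
  obtain ⟨K, Θ, r, hx, hsub, htar, hΘ, hΘs, hfst⟩ := exists_straightening hU hf hx₀ hs
  have hΘs' : ∀ z ∈ Θ.target, ContMDiffAt 𝓘(ℝ, F × K) 𝓘(ℝ, E) ∞ Θ.symm z :=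
    fun z hz => hΘs.contMDiffAt (Θ.open_target.mem_nhds hz)
  set θ : DiffForm (F × K) (F × K) k := pullback Θ.symm ξ with hθ
  have hθs : ∀ z ∈ Θ.target, SmoothFormAt θ z := fun z hz =>
    (hξ _ (hsub (Θ.map_target hz))).pullback (hΘs' z hz)
  have hk : ∀ z ∈ Θ.target, ∀ u : F × K, u.1 = 0 →
      Kills (θ z) u ∧ Kills (extDer θ z) u := by
    intro z hz u hu
    have h1 := hker _ (hsub (Θ.map_target hz)) _
      ((mfderiv_straightening_symm hΘs hfst (fun x hx => hf x (hsub hx)) hz u).trans hu)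
    refine ⟨h1.1.compContinuousLinearMap, ?_⟩
    rw [hθ, extDer_pullback (hξ _ (hsub (Θ.map_target hz))) (hΘs' z hz)]
    exact h1.2.compContinuousLinearMap
  have hmem : Θ x₀ ∈ Θ.target := Θ.map_source hx
  have hr : 0 < r := by rw [htar] at hmem; exact Metric.pos_of_mem_ball hmem
  -- The horizontal slice through `Θ x₀`; the form downstairs is the restriction of `θ` to it.
  set s : F → F × K := fun y => (y, (Θ x₀).2) with hsdef
  have hs' : ∀ y, ContMDiffAt 𝓘(ℝ, F) 𝓘(ℝ, F × K) ∞ s y := fun y =>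
    (contDiffAt_id.prodMk contDiffAt_const).contMDiffAt
  have hsder : ∀ y w, mfderiv 𝓘(ℝ, F) 𝓘(ℝ, F × K) s y w = (w, 0) := by
    intro y w
    rw [mfderiv_eq_fderiv, (hasFDerivAt_prodMk_left (𝕜 := ℝ) y (Θ x₀).2).fderiv]
    rfl
  have hsmem : ∀ y ∈ Metric.ball (Θ x₀).1 r, s y ∈ Θ.target := by
    intro y hy
    rw [htar, ← ball_prod_same]
    exact ⟨hy, Metric.mem_ball_self hr⟩
  set b : DiffForm F F k := pullback s θ with hb
  have hθb : ∀ z ∈ Θ.target, θ z = pullback (E := F × K) Prod.fst b z := by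
    intro z hz
    have hz' : z ∈ Metric.ball (Θ x₀) r := by rwa [htar] at hz
    -- The value of `θ` as an alternating form is constant along the vertical ball: this is where
    -- the hypothesis on `dξ` enters.
    have h1 : (θ z : (F × K) [⋀^Fin k]→L[ℝ] ℝ) = θ (s z.1) := by
      refine eq_of_fderiv_snd_eq_zero (V := (F × K) [⋀^Fin k]→L[ℝ] ℝ) (h := θ) (r := r) ?_ ?_ hz'
      · intro y hy
        rw [← htar] at hy
        exact (smoothFormAt_iff_contDiffAt.1 (hθs y hy)).differentiableAt (by simp)
      · intro y hy u
        rw [← htar] at hy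
        refine fderiv_apply_eq_zero_of_kills
          ((smoothFormAt_iff_contDiffAt.1 (hθs y hy)).differentiableAt (by simp)) ?_ ?_
        · filter_upwards [Θ.open_target.mem_nhds hy] with w hw
          exact (hk w hw (0, u) rfl).1
        · have := (hk y hy (0, u) rfl).2
          rwa [extDer_eq_extDeriv] at this
    have hsz : s z.1 ∈ Θ.target := by
      refine hsmem _ ?_
      rw [← ball_prod_same] at hz'
      exact hz'.1
    ext v
    have hfst' : ∀ w : F × K, mfderiv 𝓘(ℝ, F × K) 𝓘(ℝ, F) (Prod.fst : F × K → F) z w = w.1 := by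
      intro w
      rw [mfderiv_eq_fderiv, fderiv_fst]
      rfl
    change (θ z : (F × K) [⋀^Fin k]→L[ℝ] ℝ) v = (θ (s z.1) : (F × K) [⋀^Fin k]→L[ℝ] ℝ)
      (fun i => mfderiv 𝓘(ℝ, F) 𝓘(ℝ, F × K) s z.1
        (mfderiv 𝓘(ℝ, F × K) 𝓘(ℝ, F) (Prod.fst : F × K → F) z (v i)))
    rw [h1]
    -- Replacing a vector by its horizontal part alters it by a vertical vector, which `θ`
    -- annihilates.
    refine eq_of_kills_sub fun i => ?_
    refine (hk _ hsz _ ?_).1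
    rw [hsder]
    exact sub_eq_zero.2 (hfst' (v i)).symm
  refine ⟨b, ?_, ?_⟩
  · rw [← hfst x₀ hx]
    filter_upwards [Metric.ball_mem_nhds _ hr] with y hy
    exact (hθs _ (hsmem y hy)).pullback (hs' y)
  · filter_upwards [Θ.open_source.mem_nhds hx] with x hxs
    have dΘ : MDifferentiableAt 𝓘(ℝ, E) 𝓘(ℝ, F × K) Θ x :=
      (hΘ.contMDiffAt (Θ.open_source.mem_nhds hxs)).mdifferentiableAt (by simp)
    have dΘs : MDifferentiableAt 𝓘(ℝ, F × K) 𝓘(ℝ, E) Θ.symm (Θ x) :=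
      (hΘs' _ (Θ.map_source hxs)).mdifferentiableAt (by simp)
    have h1 : Θ.symm ∘ Θ =ᶠ[𝓝 x] id := by
      filter_upwards [Θ.open_source.mem_nhds hxs] with y hy
      exact Θ.left_inv hy
    have h2 : Prod.fst ∘ Θ =ᶠ[𝓝 x] f := by
      filter_upwards [Θ.open_source.mem_nhds hxs] with y hy
      exact hfst y hy
    have d3 : MDifferentiableAt 𝓘(ℝ, F × K) 𝓘(ℝ, F) (Prod.fst : F × K → F) (Θ x) :=
      differentiableAt_fst.mdifferentiableAt
    -- Near `x`, the identity is `Θ.symm ∘ Θ` and `f` is `Prod.fst ∘ Θ`, so the claim is the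
    -- pullback by `Θ` of `hθb`.
    rw [← pullback_id_apply ξ x, ← pullback_congr_map h1, pullback_comp_apply ξ dΘs dΘ,
      ← pullback_congr_map h2, pullback_comp_apply b d3 dΘ]
    exact pullback_congr_form (hθb _ (Θ.map_source hxs))

/-- If moreover the fibres are connected, the form is a pullback by the submersion. -/
theorem exists_descent (hU : IsOpen U)
    (hf : ∀ x ∈ U, ContMDiffAt 𝓘(ℝ, E) 𝓘(ℝ, F) ∞ f x)
    (hs : ∀ x ∈ U, Function.Surjective (mfderiv 𝓘(ℝ, E) 𝓘(ℝ, F) f x))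
    (hconn : ∀ y, IsPreconnected (U ∩ f ⁻¹' {y})) {ξ : DiffForm E M k}
    (hξ : ∀ x ∈ U, SmoothFormAt ξ x)
    (hker : ∀ x ∈ U, ∀ v, mfderiv 𝓘(ℝ, E) 𝓘(ℝ, F) f x v = 0 →
      Kills (ξ x) v ∧ Kills (extDer ξ x) v) :
    ∃ b : DiffForm F F k, (∀ x ∈ U, SmoothFormAt b (f x)) ∧ ∀ x ∈ U, ξ x = pullback f b x := by
  choose! β hβs hβ using fun x (hx : x ∈ U) => exists_local_descent hU hf hx (hs x hx) hξ hker
  set c : M → F [⋀^Fin k]→L[ℝ] ℝ := fun x => β x (f x) with hc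
  -- Two local descents agree at `f x'` because pullback by a surjective differential is injective.
  have hloc : ∀ x ∈ U, ∀ᶠ x' in 𝓝 x, c x' = β x (f x') := by
    intro x hx
    filter_upwards [hβ x hx, hU.mem_nhds hx] with x' h1 h2
    exact eq_of_pullback_eq (hs x' h2) ((hβ x' h2).self_of_nhds.symm.trans h1)
  have hconst : ∀ x ∈ U, ∀ x' ∈ U, f x = f x' → c x = c x' := by
    intro x hx x' hx' hxx
    have hpre := hconn (f x)
    have : PreconnectedSpace ↥(U ∩ f ⁻¹' {f x}) := isPreconnected_iff_preconnectedSpace.1 hpre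
    -- On a fibre the argument `f x'` is fixed, so `hloc` makes `c` locally constant there, hence
    -- constant by connectedness.
    have hlc : IsLocallyConstant (fun z : ↥(U ∩ f ⁻¹' {f x}) => c z) := by
      rw [IsLocallyConstant.iff_eventually_eq]
      intro z
      filter_upwards [continuous_subtype_val.continuousAt.eventually (hloc z z.2.1)] with w hw
      have h1 : f w = f z := w.2.2.trans z.2.2.symm
      rw [hw, h1]
    exact hlc.apply_eq_of_preconnectedSpace ⟨x, hx, rfl⟩ ⟨x', hx', hxx.symm⟩
  classical
  -- The value off `f(U)` is irrelevant; on `f(U)`, `hconst` makes the choice of the point in the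
  -- fibre immaterial.
  set b : DiffForm F F k := fun y =>
    if h : ∃ x ∈ U, f x = y then c h.choose else 0 with hb
  have hbc : ∀ x ∈ U, (b (f x) : F [⋀^Fin k]→L[ℝ] ℝ) = c x := by
    intro x hx
    have h : ∃ x' ∈ U, f x' = f x := ⟨x, hx, rfl⟩
    have h1 : b (f x) = c h.choose := dif_pos h
    rw [h1]
    exact hconst _ h.choose_spec.1 x hx h.choose_spec.2
  refine ⟨b, fun x hx => ?_, fun x hx => ?_⟩
  · refine (hβs x hx).self_of_nhds.congr ?_
    -- As `f` is open, an identity near `f x` can be checked upstairs near `x`.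
    rw [← map_nhds_eq_of_submersion hU hf hx (hs x hx), Filter.eventually_map]
    filter_upwards [hloc x hx, hU.mem_nhds hx] with x' h1 h2
    exact (hbc x' h2).trans h1
  · rw [(hβ x hx).self_of_nhds]
    exact pullback_congr_form (hbc x hx).symm

end LocalDescent

/-! ### Maps on an open subset, extended to the whole manifold -/

section Extend

variable {E : Type*} [NormedAddCommGroup E] [NormedSpace ℝ E]
  {F : Type*} [NormedAddCommGroup F] [NormedSpace ℝ F]
  {M : Type*} [TopologicalSpace M] [ChartedSpace E M]
  {N : Type*} [TopologicalSpace N] [ChartedSpace F N] {U : Opens M}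

theorem extend_val_apply {N : Type*} (f : U → N) (d : M → N) (x : U) :
    Function.extend Subtype.val f d x = f x :=
  Subtype.val_injective.extend_apply f d x

/-- Extending maps on `U` by an arbitrary `d` makes them maps on `M`, to which the descent results
apply. Since `U` is open, `d` has no influence on derivatives at points of `U`. -/
theorem contMDiffAt_extend_val {f : U → N} (d : M → N) {x : U}
    (hf : ContMDiffAt 𝓘(ℝ, E) 𝓘(ℝ, F) ∞ f x) :
    ContMDiffAt 𝓘(ℝ, E) 𝓘(ℝ, F) ∞ (Function.extend Subtype.val f d) (x : M) := by
  rw [← contMDiffAt_subtype_iff]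
  simpa only [extend_val_apply] using hf

theorem mfderiv_extend_val {f : U → N} (d : M → N) {x : U}
    (hf : ContMDiffAt 𝓘(ℝ, E) 𝓘(ℝ, F) ∞ f x) (v : E) :
    (mfderiv 𝓘(ℝ, E) 𝓘(ℝ, F) f x : E →L[ℝ] F) v =
      (mfderiv 𝓘(ℝ, E) 𝓘(ℝ, F) (Function.extend Subtype.val f d) (x : M) : E →L[ℝ] F)
        ((mfderiv 𝓘(ℝ, E) 𝓘(ℝ, E) (Subtype.val : U → M) x : E →L[ℝ] E) v) := by
  have h : f = Function.extend Subtype.val f d ∘ Subtype.val :=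
    funext fun x => (extend_val_apply f d x).symm
  have h1 : (mfderiv 𝓘(ℝ, E) 𝓘(ℝ, F) f x : E →L[ℝ] F) =
      (mfderiv 𝓘(ℝ, E) 𝓘(ℝ, F) (Function.extend Subtype.val f d ∘ Subtype.val) x :
        E →L[ℝ] F) := by
    congr 1
  rw [h1, mfderiv_comp x ((contMDiffAt_extend_val d hf).mdifferentiableAt (by simp))
    ((contMDiff_subtype_val (n := ∞) x).mdifferentiableAt (by simp))]
  rfl

/-- The identity of `U`, extended to `M` by a constant, is near `x` a smooth right inverse of the
inclusion. -/
theorem mfderiv_val_surjective (x : U) :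
    Function.Surjective (mfderiv 𝓘(ℝ, E) 𝓘(ℝ, E) (Subtype.val : U → M) x) := by
  set r : M → U := Function.extend Subtype.val id (fun _ => x) with hr
  have hrx : r x = x := extend_val_apply id _ x
  have hev : Subtype.val ∘ r =ᶠ[𝓝 (x : M)] id := by
    filter_upwards [U.isOpen.mem_nhds x.2] with z hz
    exact congrArg Subtype.val (extend_val_apply (U := U) id (fun _ => x) ⟨z, hz⟩)
  have d1 : MDifferentiableAt 𝓘(ℝ, E) 𝓘(ℝ, E) r x :=
    (contMDiffAt_extend_val (E := E) (F := E) (f := (id : U → U)) (fun _ => x)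
      contMDiffAt_id).mdifferentiableAt (by simp)
  have d2 : MDifferentiableAt 𝓘(ℝ, E) 𝓘(ℝ, E) (Subtype.val : U → M) (r x) :=
    (contMDiff_subtype_val (n := ∞) (r x)).mdifferentiableAt (by simp)
  have h1 : (mfderiv 𝓘(ℝ, E) 𝓘(ℝ, E) (Subtype.val ∘ r) (x : M) : E →L[ℝ] E) =
      mfderiv 𝓘(ℝ, E) 𝓘(ℝ, E) id (x : M) := hev.mfderiv_eq
  rw [mfderiv_comp _ d2 d1, mfderiv_id] at h1
  intro v
  refine ⟨(mfderiv 𝓘(ℝ, E) 𝓘(ℝ, E) r (x : M) : E →L[ℝ] E) v, ?_⟩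
  have h2 := congrArg (fun L : E →L[ℝ] E => L v) h1
  have h3 : (mfderiv 𝓘(ℝ, E) 𝓘(ℝ, E) (Subtype.val : U → M) (r x) : E →L[ℝ] E) =
    mfderiv 𝓘(ℝ, E) 𝓘(ℝ, E) (Subtype.val : U → M) x := by rw [hrx]
  rw [← h3]
  exact h2

theorem surjective_mfderiv_extend_val {f : U → N} (d : M → N) {x : U}
    (hf : ContMDiffAt 𝓘(ℝ, E) 𝓘(ℝ, F) ∞ f x)
    (hs : Function.Surjective (mfderiv 𝓘(ℝ, E) 𝓘(ℝ, F) f x)) :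
    Function.Surjective
      (mfderiv 𝓘(ℝ, E) 𝓘(ℝ, F) (Function.extend Subtype.val f d) (x : M)) := by
  intro w
  obtain ⟨v, hv⟩ := hs w
  exact ⟨_, (mfderiv_extend_val d hf v).symm.trans hv⟩

theorem pullback_extend_val {k : ℕ} {f : U → N} (d : M → N) {x : U}
    (hf : ContMDiffAt 𝓘(ℝ, E) 𝓘(ℝ, F) ∞ f x) (α : DiffForm F N k) :
    pullback (E := E) f α x = pullback (E := E) (Subtype.val : U → M)
      (pullback (E := E) (Function.extend Subtype.val f d) α) x := by
  have h : f = Function.extend Subtype.val f d ∘ Subtype.val :=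
    funext fun x => (extend_val_apply f d x).symm
  conv_lhs => rw [h]
  exact pullback_comp_apply α ((contMDiffAt_extend_val d hf).mdifferentiableAt (by simp))
    ((contMDiff_subtype_val (n := ∞) x).mdifferentiableAt (by simp))

/-- Every tangent vector of `M` at a point of `U` comes from `U`, so the condition, stated on `U`,
can be tested on `M`. -/
theorem IsTangentToFibres.mem_iff {D : ∀ x : M, Submodule ℝ (TangentSpace 𝓘(ℝ, E) x)} {f : U → F}
    (hf : IsSmoothSubmersion (E := E) f) (h : IsTangentToFibres D U f) (d : M → F) {x : M}
    (hx : x ∈ U) (v : TangentSpace 𝓘(ℝ, E) x) :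
    v ∈ D x ↔ mfderiv 𝓘(ℝ, E) 𝓘(ℝ, F) (Function.extend Subtype.val f d) x v = 0 := by
  obtain ⟨w, rfl⟩ := mfderiv_val_surjective (E := E) (⟨x, hx⟩ : U) v
  have h1 := mfderiv_extend_val d (hf.1 ⟨x, hx⟩) w
  refine (h ⟨x, hx⟩ w).trans ?_
  exact ⟨fun h => h1.symm.trans h, fun h => h1.trans h⟩

end Extend

/-! ### Extending tangent vectors to tangent vector fields -/

section TangentField

/-- On a normed space, a vector tangent to a fibre of a submersion extends to a smooth vector field
tangent to the fibres. -/
theorem exists_flat_tangentField {E : Type*} [NormedAddCommGroup E] [NormedSpace ℝ E]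
    {F : Type*} [NormedAddCommGroup F] [NormedSpace ℝ F] [FiniteDimensional ℝ F]
    {g : E → F} {O : Set E} (hO : IsOpen O)
    (hg : ContDiffOn ℝ ∞ g O) {a : E} (ha : a ∈ O)
    (hs : Function.Surjective (fderiv ℝ g a)) {v : E} (hv : fderiv ℝ g a v = 0) :
    ∃ (O' : Set E) (T : E → E), IsOpen O' ∧ O' ⊆ O ∧ a ∈ O' ∧ ContDiffOn ℝ ∞ T O' ∧ T a = v ∧
      ∀ y ∈ O', fderiv ℝ g y (T y) = 0 := by
  have := FiniteDimensional.complete ℝ F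
  obtain ⟨R, hR⟩ := (fderiv ℝ g a).exists_rightInverse_of_surjective (LinearMap.range_eq_top.2 hs)
  have hg' : ContDiffOn ℝ ∞ (fderiv ℝ g) O := hg.fderiv_of_isOpen hO (by simp)
  have hgR : ContDiffOn ℝ ∞ (fun y => (fderiv ℝ g y).comp R) O := hg'.clm_comp contDiffOn_const
  have hopen : IsOpen (O ∩ (fun y => (fderiv ℝ g y).comp R) ⁻¹'
      (range ((↑) : (F ≃L[ℝ] F) → F →L[ℝ] F))) :=
    hgR.continuousOn.isOpen_inter_preimage hO ContinuousLinearEquiv.isOpen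
  -- With `R` a right inverse of the derivative `Dg` at `a`, the composite of `Dg` at `y` with `R`
  -- stays invertible near `a`. The constant field `v` is then corrected by the vector in the range
  -- of `R` with the same image under `Dg`; at `a` the correction is zero.
  refine ⟨_, fun y => v - R (((fderiv ℝ g y).comp R).inverse (fderiv ℝ g y v)), hopen,
    inter_subset_left, ⟨ha, ContinuousLinearEquiv.refl ℝ F, ?_⟩, ?_, ?_, ?_⟩
  · exact hR.symm
  · rintro y ⟨hy, L, hL⟩
    have hinv : ContDiffAt ℝ ∞ (ContinuousLinearMap.inverse : (F →L[ℝ] F) → F →L[ℝ] F)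
        ((fderiv ℝ g y).comp R) := by
      rw [← show (L : F →L[ℝ] F) = (fderiv ℝ g y).comp R from hL]
      exact contDiffAt_map_inverse L
    have h1 : ContDiffAt ℝ ∞ (fderiv ℝ g) y := hg'.contDiffAt (hO.mem_nhds hy)
    have h2 : ContDiffAt ℝ ∞ (fun y => (fderiv ℝ g y).comp R) y :=
      hgR.contDiffAt (hO.mem_nhds hy)
    exact (contDiffAt_const.sub (R.contDiff.contDiffAt.comp y
      ((hinv.comp y h2).clm_apply (h1.clm_apply contDiffAt_const)))).contDiffWithinAt
  · simp [hv]
  · rintro y ⟨hy, L, hL⟩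
    have hi : ((fderiv ℝ g y).comp R).IsInvertible := ⟨L, hL⟩
    have := hi.self_apply_inverse (fderiv ℝ g y v)
    rw [map_sub, sub_eq_zero]
    exact this.symm

variable {E : Type*} [NormedAddCommGroup E] [NormedSpace ℝ E] [FiniteDimensional ℝ E]
  {F : Type*} [NormedAddCommGroup F] [NormedSpace ℝ F] [FiniteDimensional ℝ F]
  {M : Type*} [TopologicalSpace M] [T2Space M] [ChartedSpace E M] [IsManifold 𝓘(ℝ, E) ∞ M] {k : ℕ}

/-- Every vector tangent to a foliation extends to a vector field tangent to the foliation. -/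
theorem Foliation.exists_tangentField (ℱ : Foliation E F M) {x₀ : M}
    {v : TangentSpace 𝓘(ℝ, E) x₀} (hv : v ∈ ℱ.tangent x₀) :
    ∃ T, ℱ.IsTangentField T ∧ T x₀ = v := by
  have : CompleteSpace E := FiniteDimensional.complete ℝ E
  have : IsManifold 𝓘(ℝ, E) 1 M := IsManifold.of_le one_le_infty
  obtain ⟨U, p, hx₀, hp, hpt⟩ := ℱ.exists_submersion x₀
  set f : M → F := Function.extend Subtype.val p (fun _ => 0) with hfdef
  have hf : ∀ x ∈ U, ContMDiffAt 𝓘(ℝ, E) 𝓘(ℝ, F) ∞ f x := fun x hx =>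
    contMDiffAt_extend_val _ (hp.1 ⟨x, hx⟩)
  have hs : Function.Surjective (mfderiv 𝓘(ℝ, E) 𝓘(ℝ, F) f x₀) :=
    surjective_mfderiv_extend_val _ (hp.1 ⟨x₀, hx₀⟩) (hp.2 ⟨x₀, hx₀⟩)
  have hmem : ∀ x ∈ U, ∀ w, w ∈ ℱ.tangent x ↔ mfderiv 𝓘(ℝ, E) 𝓘(ℝ, F) f x w = 0 :=
    fun x hx w => hpt.mem_iff hp _ hx w
  set c := chartAt E x₀ with hc
  have hx : x₀ ∈ c.source := mem_chart_source E x₀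
  have hcm := IsManifold.chart_mem_maximalAtlas (I := 𝓘(ℝ, E)) (n := ∞) x₀
  have hder := mfderiv_eq_fderiv_comp_chart hx (hf x₀ hx₀)
  obtain ⟨O', T, hO', hO'sub, haO', hTs, hTa, hTk⟩ := exists_flat_tangentField
    (g := f ∘ c.symm) (O := c.target ∩ c.symm ⁻¹' (U : Set M)) (a := c x₀)
    (v := mfderiv 𝓘(ℝ, E) 𝓘(ℝ, E) c x₀ v)
    (c.isOpen_inter_preimage_symm U.isOpen) (contDiffOn_comp_chart_symm hf)
    ⟨c.map_source hx, by simpa [c.left_inv hx] using hx₀⟩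
    (fun w => by
      obtain ⟨u, hu⟩ := hs w
      exact ⟨_, (congrArg (fun L : E →L[ℝ] F => L u) hder).symm.trans hu⟩)
    ((congrArg (fun L : E →L[ℝ] F => L v) hder).symm.trans ((hmem x₀ hx₀ v).1 hv))
  set u := c.source ∩ c ⁻¹' O' with hu
  have huo : IsOpen u := c.isOpen_inter_preimage hO'
  have hxu : x₀ ∈ u := ⟨hx, haO'⟩
  set S : ∀ x : M, TangentSpace 𝓘(ℝ, E) x := VectorField.mpullback 𝓘(ℝ, E) 𝓘(ℝ, E) c T with hS
  have hSs : ContMDiffOn 𝓘(ℝ, E) (𝓘(ℝ, E).prod 𝓘(ℝ, E)) ∞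
      (fun x => (⟨x, S x⟩ : TangentBundle 𝓘(ℝ, E) M)) u := by
    rintro x ⟨hxs, hxO⟩
    refine ContMDiffAt.contMDiffWithinAt ?_
    have hT : ContMDiffAt 𝓘(ℝ, E) (𝓘(ℝ, E).prod 𝓘(ℝ, E)) ∞
        (fun y => (⟨y, T y⟩ : TangentBundle 𝓘(ℝ, E) E)) (c x) := by
      have := (hTs.contDiffAt (hO'.mem_nhds hxO)).contDiffWithinAt (s := univ)
      exact contMDiffWithinAt_univ.1 (contMDiffWithinAt_vectorSpace_iff_contDiffWithinAt.2 this)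
    exact ContMDiffAt.mpullback_vectorField_preimage (n := ∞) hT
      (contMDiffAt_of_mem_maximalAtlas hcm hxs)
      (isInvertible_mfderiv_chart hxs) (by simp)
  -- A bump function supported in `u` and equal to `1` at `x₀` makes the local field `S` global.
  -- Tangency persists, as each tangent space is a subspace.
  obtain ⟨ψ, -, hψ⟩ := (SmoothBumpFunction.nhds_basis_tsupport (I := 𝓘(ℝ, E)) x₀).mem_iff.1
    (huo.mem_nhds hxu)
  refine ⟨fun x => ψ x • S x, ⟨?_, fun x => ?_⟩, ?_⟩
  · exact ContMDiffOn.smul_section_of_tsupport ψ.contMDiff.contMDiffOn huo hψ hSs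
  · by_cases hxu : x ∈ u
    · refine Submodule.smul_mem _ _ ?_
      have hxU : x ∈ U := by
        have := (hO'sub hxu.2).2
        rwa [mem_preimage, c.left_inv hxu.1] at this
      rw [hmem x hxU]
      have h1 := (isInvertible_mfderiv_chart (E := E) hxu.1).self_apply_inverse (T (c x))
      refine (congrArg (fun L : E →L[ℝ] F => L (S x))
        (mfderiv_eq_fderiv_comp_chart hxu.1 (hf x hxU))).trans ?_
      refine Eq.trans ?_ (hTk _ hxu.2)
      exact congrArg (fun z : E => fderiv ℝ (f ∘ c.symm) (c x) z) h1
    · have : ψ x = 0 := image_eq_zero_of_notMem_tsupport fun h => hxu (hψ h)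
      have h0 : ψ x • S x = 0 := by rw [this, zero_smul]
      change ψ x • S x ∈ ℱ.tangent x
      rw [h0]
      exact Submodule.zero_mem _
  · have h1 : ψ x₀ = 1 := ψ.eq_one
    change ψ x₀ • S x₀ = v
    rw [h1, one_smul]
    refine (congrArg (fun z : E => (mfderiv 𝓘(ℝ, E) 𝓘(ℝ, E) c x₀).inverse z) hTa).trans ?_
    exact (isInvertible_mfderiv_chart (E := E) hx).inverse_apply_self v

end TangentField

/-! ### Pointwise characterization of basic forms -/

section Basic

variable {E : Type*} [NormedAddCommGroup E] [NormedSpace ℝ E]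
  {F : Type*} [NormedAddCommGroup F] [NormedSpace ℝ F]
  {M : Type*} [TopologicalSpace M] [ChartedSpace E M] {k : ℕ}

theorem interiorProd_eq_zero_iff {T : ∀ x : M, TangentSpace 𝓘(ℝ, E) x}
    {α : DiffForm E M (k + 1)} : interiorProd T α = 0 ↔ ∀ x, Kills (α x) (T x) := by
  constructor
  · intro h x
    rw [kills_iff_cons]
    intro w
    exact DFunLike.congr_fun (congrFun h x) w
  · intro h
    funext x
    ext w
    exact kills_iff_cons.1 (h x) w

theorem interiorEqZero_iff {T : ∀ x : M, TangentSpace 𝓘(ℝ, E) x} {α : DiffForm E M k} :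
    InteriorEqZero T α ↔ ∀ x, Kills (α x) (T x) := by
  cases k with
  | zero => exact ⟨fun _ _ _ ⟨i, _⟩ => i.elim0, fun _ => trivial⟩
  | succ k => exact interiorProd_eq_zero_iff

/-- A form is basic if and only if the contractions of the form and of its exterior derivative with
the vectors tangent to the foliation vanish. -/
theorem mem_basicForms_iff [FiniteDimensional ℝ E] [FiniteDimensional ℝ F] [T2Space M]
    [IsManifold 𝓘(ℝ, E) ∞ M] {ℱ : Foliation E F M} {ξ : DiffForm E M k} :
    ξ ∈ basicForms ℱ k ↔ IsSmoothForm ξ ∧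
      ∀ x, ∀ v ∈ ℱ.tangent x, Kills (ξ x) v ∧ Kills (extDer ξ x) v := by
  constructor
  · rintro ⟨hs, h⟩
    refine ⟨hs, fun x v hv => ?_⟩
    -- The definition tests only global fields; realizing `v` as a value of one makes the condition
    -- pointwise.
    obtain ⟨T, hT, rfl⟩ := ℱ.exists_tangentField hv
    obtain ⟨h1, h2⟩ := h T hT
    rw [lieDer_of_interiorEqZero h1] at h2
    exact ⟨interiorEqZero_iff.1 h1 x, interiorProd_eq_zero_iff.1 h2 x⟩
  · rintro ⟨hs, h⟩
    refine ⟨hs, fun T hT => ?_⟩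
    have h1 : InteriorEqZero T ξ := interiorEqZero_iff.2 fun x => (h x _ (hT.2 x)).1
    refine ⟨h1, ?_⟩
    rw [lieDer_of_interiorEqZero h1]
    exact interiorProd_eq_zero_iff.2 fun x => (h x _ (hT.2 x)).2

end Basic

/-! ### The inclusion of a disjoint union of open sets in the model space -/

section DisjUnionSmooth

variable {F : Type*} [NormedAddCommGroup F] {ι : Type*} {V : ι → Opens F}

/-- The local homeomorphism from `∐ V i` to `F` whose restriction to every summand is the
inclusion. -/
def DisjUnion.incl (V : ι → Opens F) (z : DisjUnion V) : F := (z.2 : F)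

theorem DisjUnion.chartAt_apply {z w : DisjUnion V} (h : w.1 = z.1) :
    chartAt F z w = DisjUnion.incl V w := by
  obtain ⟨i, a⟩ := z
  obtain ⟨j, b⟩ := w
  obtain rfl : j = i := h
  exact DisjUnion.chart_apply V ⟨j, a⟩ b

theorem DisjUnion.mem_chartAt_source {z w : DisjUnion V} :
    w ∈ (chartAt F z).source ↔ w.1 = z.1 := by
  have h : (chartAt F z).source = range (Sigma.mk (β := fun i => V i) z.1) :=
    DisjUnion.chart_source V z
  rw [h]
  constructor
  · rintro ⟨y, rfl⟩
    rfl
  · obtain ⟨i, a⟩ := z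
    obtain ⟨j, b⟩ := w
    rintro (rfl : j = i)
    exact ⟨b, rfl⟩

theorem DisjUnion.chartAt_symm_apply {z w : DisjUnion V} (h : w.1 = z.1) :
    (chartAt F z).symm (DisjUnion.incl V w) = w := by
  rw [← DisjUnion.chartAt_apply h, (chartAt F z).left_inv (DisjUnion.mem_chartAt_source.2 h)]

theorem DisjUnion.incl_mem_chartAt_target {z w : DisjUnion V} (h : w.1 = z.1) :
    DisjUnion.incl V w ∈ (chartAt F z).target := by
  rw [← DisjUnion.chartAt_apply h]
  exact (chartAt F z).map_source (DisjUnion.mem_chartAt_source.2 h)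

theorem DisjUnion.eventually_fst_eq (z : DisjUnion V) : ∀ᶠ w in 𝓝 z, w.1 = z.1 := by
  filter_upwards [(chartAt F z).open_source.mem_nhds (mem_chart_source F z)] with w hw
  exact DisjUnion.mem_chartAt_source.1 hw

variable [NormedSpace ℝ F]

theorem DisjUnion.contMDiffAt_incl (z : DisjUnion V) :
    ContMDiffAt 𝓘(ℝ, F) 𝓘(ℝ, F) ∞ (DisjUnion.incl V) z := by
  have h := contMDiffAt_of_mem_maximalAtlas
    (IsManifold.chart_mem_maximalAtlas (I := 𝓘(ℝ, F)) (n := ∞) z) (mem_chart_source F z)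
  refine h.congr_of_eventuallyEq ?_
  filter_upwards [DisjUnion.eventually_fst_eq z] with w hw
  exact (DisjUnion.chartAt_apply hw).symm

/-- Near `z` the inclusion coincides with a chart, whose differential is invertible. -/
theorem DisjUnion.mfderiv_incl_injective (z : DisjUnion V) :
    Function.Injective (mfderiv 𝓘(ℝ, F) 𝓘(ℝ, F) (DisjUnion.incl V) z) := by
  have h : (chartAt F z : DisjUnion V → F) =ᶠ[𝓝 z] DisjUnion.incl V := by
    filter_upwards [DisjUnion.eventually_fst_eq z] with w hw
    exact DisjUnion.chartAt_apply hw
  have h1 : (mfderiv 𝓘(ℝ, F) 𝓘(ℝ, F) (chartAt F z) z : F →L[ℝ] F) =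
    mfderiv 𝓘(ℝ, F) 𝓘(ℝ, F) (DisjUnion.incl V) z := h.mfderiv_eq
  have h2 : Function.Injective (mfderiv 𝓘(ℝ, F) 𝓘(ℝ, F) (chartAt F z) z : F →L[ℝ] F) :=
    (isInvertible_mfderiv_chart (E := F) (mem_chart_source F z)).injective
  rw [h1] at h2
  exact h2

end DisjUnionSmooth

/-! ### The submersions of the atlas as maps on `M` -/

section ExtendedSubmersions

variable {E : Type*} [NormedAddCommGroup E] [NormedSpace ℝ E]
  {F : Type*} [NormedAddCommGroup F] [NormedSpace ℝ F]
  {M : Type*} [TopologicalSpace M] [ChartedSpace E M]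
  {ℱ : Foliation E F M} {ι : Type*} (A : FoliatedAtlas ℱ ι)

namespace FoliatedAtlas

/-- The submersion `p i`, extended by zero to `M`. -/
def pExt (i : ι) : M → F := Function.extend Subtype.val (A.p i) fun _ => 0

theorem pExt_apply (i : ι) (x : A.U i) : A.pExt i x = A.p i x := extend_val_apply _ _ x

theorem contMDiffAt_pExt {i : ι} {x : M} (hx : x ∈ A.U i) :
    ContMDiffAt 𝓘(ℝ, E) 𝓘(ℝ, F) ∞ (A.pExt i) x :=
  contMDiffAt_extend_val _ ((A.submersion i).1 ⟨x, hx⟩)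

theorem mfderiv_pExt_surjective {i : ι} {x : M} (hx : x ∈ A.U i) :
    Function.Surjective (mfderiv 𝓘(ℝ, E) 𝓘(ℝ, F) (A.pExt i) x) :=
  surjective_mfderiv_extend_val _ ((A.submersion i).1 ⟨x, hx⟩) ((A.submersion i).2 ⟨x, hx⟩)

theorem mem_tangent_iff {i : ι} {x : M} (hx : x ∈ A.U i) (v : TangentSpace 𝓘(ℝ, E) x) :
    v ∈ ℱ.tangent x ↔ mfderiv 𝓘(ℝ, E) 𝓘(ℝ, F) (A.pExt i) x v = 0 :=
  (A.tangent i).mem_iff (A.submersion i) _ hx v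

theorem isPreconnected_fibre_pExt (i : ι) (y : F) :
    IsPreconnected ((A.U i : Set M) ∩ A.pExt i ⁻¹' {y}) := by
  have h : (A.U i : Set M) ∩ A.pExt i ⁻¹' {y} = Subtype.val '' (A.p i ⁻¹' {y}) := by
    ext x
    constructor
    · rintro ⟨hx, hy⟩
      exact ⟨⟨x, hx⟩, (A.pExt_apply i ⟨x, hx⟩).symm.trans hy, rfl⟩
    · rintro ⟨x, hx, rfl⟩
      exact ⟨x.2, (A.pExt_apply i x).trans hx⟩
  rw [h]
  exact (A.connected i y).image _ continuous_subtype_val.continuousOn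

end FoliatedAtlas

end ExtendedSubmersions

/-! ### The projections to the transverse manifold -/

section Projections

variable {E : Type*} [NormedAddCommGroup E] [NormedSpace ℝ E] [CompleteSpace E]
  {F : Type*} [NormedAddCommGroup F] [NormedSpace ℝ F] [CompleteSpace F]
  {M : Type*} [TopologicalSpace M] [ChartedSpace E M]
  {ℱ : Foliation E F M} {ι : Type*} (A : FoliatedAtlas ℱ ι)

namespace FoliatedAtlas

/-- The projection takes values in a single summand, so one inverse chart, composed with `p i`,
expresses it on all of `U i`. -/
theorem contMDiff_proj (i : ι) : ContMDiff 𝓘(ℝ, E) 𝓘(ℝ, F) ∞ (A.proj i) := by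
  intro x
  have h1 : A.proj i = (chartAt F (A.proj i x)).symm ∘ A.p i := by
    funext y
    exact (DisjUnion.chartAt_symm_apply (z := A.proj i x) (w := A.proj i y) rfl).symm
  rw [h1]
  have h2 := contMDiffAt_symm_of_mem_maximalAtlas
    (IsManifold.chart_mem_maximalAtlas (I := 𝓘(ℝ, F)) (n := ∞) (A.proj i x))
    (DisjUnion.incl_mem_chartAt_target (z := A.proj i x) (w := A.proj i x) rfl)
  exact ContMDiffAt.comp x (g := (chartAt F (A.proj i x)).symm) h2 ((A.submersion i).1 x)

theorem mfderiv_p (i : ι) (x : A.U i) (v : E) :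
    (mfderiv 𝓘(ℝ, E) 𝓘(ℝ, F) (A.p i) x : E →L[ℝ] F) v =
      (mfderiv 𝓘(ℝ, F) 𝓘(ℝ, F) (DisjUnion.incl A.image) (A.proj i x) : F →L[ℝ] F)
        ((mfderiv 𝓘(ℝ, E) 𝓘(ℝ, F) (A.proj i) x : E →L[ℝ] F) v) := by
  have h := mfderiv_comp x ((DisjUnion.contMDiffAt_incl (A.proj i x)).mdifferentiableAt (by simp))
    ((A.contMDiff_proj i x).mdifferentiableAt (by simp))
  exact congrArg (fun L : E →L[ℝ] F => L v) h

/-- The differential of `p i` is that of the projection followed by that of `DisjUnion.incl`; as the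
composite is surjective and the second factor injective, the first factor is surjective. -/
theorem mfderiv_proj_surjective (i : ι) (x : A.U i) :
    Function.Surjective (mfderiv 𝓘(ℝ, E) 𝓘(ℝ, F) (A.proj i) x) := by
  intro w
  obtain ⟨v, hv⟩ := (A.submersion i).2 x
    ((mfderiv 𝓘(ℝ, F) 𝓘(ℝ, F) (DisjUnion.incl A.image) (A.proj i x) : F →L[ℝ] F) w)
  exact ⟨v, DisjUnion.mfderiv_incl_injective (A.proj i x) ((A.mfderiv_p i x v).symm.trans hv)⟩

theorem pullback_p {k : ℕ} (i : ι) (x : A.U i) (b : DiffForm F F k) :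
    pullback (E := E) (A.p i) b x =
      pullback (E := E) (A.proj i) (pullback (E := F) (DisjUnion.incl A.image) b) x :=
  pullback_comp_apply (g := DisjUnion.incl A.image) (f := A.proj i) b
    ((DisjUnion.contMDiffAt_incl (A.proj i x)).mdifferentiableAt (by simp))
    ((A.contMDiff_proj i x).mdifferentiableAt (by simp))

/-- The projection to the transverse manifold, extended to `M` by a constant. -/
def projExt (i : ι) (x₀ : A.U i) : M → A.Transverse :=
  Function.extend Subtype.val (A.proj i) fun _ => A.proj i x₀

theorem projExt_apply (i : ι) (x₀ x : A.U i) : A.projExt i x₀ x = A.proj i x :=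
  extend_val_apply _ _ x

theorem contMDiffAt_projExt {i : ι} (x₀ : A.U i) {x : M} (hx : x ∈ A.U i) :
    ContMDiffAt 𝓘(ℝ, E) 𝓘(ℝ, F) ∞ (A.projExt i x₀) x :=
  contMDiffAt_extend_val _ (A.contMDiff_proj i ⟨x, hx⟩)

theorem mfderiv_projExt_surjective {i : ι} (x₀ : A.U i) {x : M} (hx : x ∈ A.U i) :
    Function.Surjective (mfderiv 𝓘(ℝ, E) 𝓘(ℝ, F) (A.projExt i x₀) x) :=
  surjective_mfderiv_extend_val _ (A.contMDiff_proj i ⟨x, hx⟩)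
    (A.mfderiv_proj_surjective i ⟨x, hx⟩)

/-- The differential of `p i` annihilates tangent vectors, and it determines that of the projection
because `DisjUnion.incl` has injective differential. -/
theorem mfderiv_projExt_eq_zero {i : ι} (x₀ : A.U i) {x : M} (hx : x ∈ A.U i)
    {v : TangentSpace 𝓘(ℝ, E) x} (hv : v ∈ ℱ.tangent x) :
    mfderiv 𝓘(ℝ, E) 𝓘(ℝ, F) (A.projExt i x₀) x v = 0 := by
  obtain ⟨w, rfl⟩ := mfderiv_val_surjective (E := E) (⟨x, hx⟩ : A.U i) v
  have h1 := (A.tangent i ⟨x, hx⟩ w).1 hv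
  have h2 : (mfderiv 𝓘(ℝ, E) 𝓘(ℝ, F) (A.proj i) ⟨x, hx⟩ : E →L[ℝ] F) w = 0 := by
    refine DisjUnion.mfderiv_incl_injective (A.proj i ⟨x, hx⟩) ?_
    exact (A.mfderiv_p i ⟨x, hx⟩ w).symm.trans (h1.trans (map_zero _).symm)
  exact (mfderiv_extend_val _ (A.contMDiff_proj i ⟨x, hx⟩) w).symm.trans h2

theorem pullback_proj {k : ℕ} {i : ι} (x₀ x : A.U i) (η : DiffForm F A.Transverse k) :
    pullback (E := E) (A.proj i) η x =
      pullback (E := E) (Subtype.val : A.U i → M) (pullback (E := E) (A.projExt i x₀) η) x :=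
  pullback_extend_val _ (A.contMDiff_proj i x) η

end FoliatedAtlas

end Projections

/-! ### Existence of transition diffeomorphisms -/

section Transitions

variable {E : Type*} [NormedAddCommGroup E] [NormedSpace ℝ E] [CompleteSpace E]
  {F : Type*} [NormedAddCommGroup F] [NormedSpace ℝ F] [FiniteDimensional ℝ F] [CompleteSpace F]
  {M : Type*} [TopologicalSpace M] [ChartedSpace E M] [IsManifold 𝓘(ℝ, E) ∞ M]
  {ℱ : Foliation E F M} {ι : Type*} (A : FoliatedAtlas ℱ ι)

/-- On the overlaps of the atlas, the submersions differ locally by a diffeomorphism. -/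
theorem FoliatedAtlas.exists_local_diffeo {i j : ι} {x : M} (hi : x ∈ A.U i) (hj : x ∈ A.U j) :
    ∃ Ψ : OpenPartialHomeomorph F F, A.pExt j x ∈ Ψ.source ∧ ContDiffOn ℝ ∞ Ψ Ψ.source ∧
      ContDiffOn ℝ ∞ Ψ.symm Ψ.target ∧ ∀ᶠ y in 𝓝 x, A.pExt i y = Ψ (A.pExt j y) := by
  -- The differentials of `p i` and `p j` have the same kernel, the tangent distribution, so `p i`
  -- factors locally through `p j`.
  obtain ⟨h, hh, hfac⟩ := exists_local_factor (U := (A.U i : Set M) ∩ A.U j)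
    ((A.U i).isOpen.inter (A.U j).isOpen) (f := A.pExt j) (g := A.pExt i)
    (fun y hy => A.contMDiffAt_pExt hy.2) ⟨hi, hj⟩ (A.mfderiv_pExt_surjective hj)
    (fun y hy => A.contMDiffAt_pExt hy.1)
    (fun y hy v hv => (A.mem_tangent_iff hy.1 v).1 ((A.mem_tangent_iff hy.2 v).2 hv))
  obtain ⟨O, hOsub, hO, hxO⟩ := eventually_nhds_iff.1 hh
  have hhO : ContDiffOn ℝ ∞ h O := fun y hy => (hOsub y hy).contDiffWithinAt
  -- The differential of `p i` is onto and factors through that of `h`. Both sides having the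
  -- dimension of `F`, surjectivity will also give injectivity.
  have hsurj : Function.Surjective (fderiv ℝ h (A.pExt j x)) := by
    intro w
    obtain ⟨v, hv⟩ := A.mfderiv_pExt_surjective hi w
    have d1 : MDifferentiableAt 𝓘(ℝ, F) 𝓘(ℝ, F) h (A.pExt j x) :=
      (hh.self_of_nhds.differentiableAt (by simp)).mdifferentiableAt
    have d2 : MDifferentiableAt 𝓘(ℝ, E) 𝓘(ℝ, F) (A.pExt j) x :=
      (A.contMDiffAt_pExt hj).mdifferentiableAt (by simp)
    have hev : A.pExt i =ᶠ[𝓝 x] h ∘ A.pExt j := hfac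
    have h1 : (mfderiv 𝓘(ℝ, E) 𝓘(ℝ, F) (A.pExt i) x : E →L[ℝ] F) =
      mfderiv 𝓘(ℝ, E) 𝓘(ℝ, F) (h ∘ A.pExt j) x := hev.mfderiv_eq
    rw [mfderiv_comp x d1 d2, mfderiv_eq_fderiv] at h1
    exact ⟨_, (congrArg (fun L : E →L[ℝ] F => L v) h1).symm.trans hv⟩
  have hinj : Function.Injective (fderiv ℝ h (A.pExt j x)) :=
    LinearMap.injective_iff_surjective.2 hsurj
  have hinv : (fderiv ℝ h (A.pExt j x)).IsInvertible :=
    ⟨ContinuousLinearEquiv.ofBijective _ (LinearMap.ker_eq_bot.2 hinj)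
      (LinearMap.range_eq_top.2 hsurj), by ext; rfl⟩
  obtain ⟨Ψ, hΨx, hΨO, hΨ, hΨs⟩ := exists_smooth_inverse hO hhO hxO hinv
  refine ⟨Ψ, hΨx, ?_, hΨs, ?_⟩
  · rw [hΨ]
    exact hhO.mono hΨO
  · rw [hΨ]
    exact hfac

/-- The Haefliger cocycle has enough elements. -/
theorem FoliatedAtlas.exists_transition {i j : ι} {x : M} (hi : x ∈ A.U i) (hj : x ∈ A.U j) :
    ∃ γ, A.IsTransition γ ∧ A.proj j ⟨x, hj⟩ ∈ γ.source ∧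
      ∀ᶠ y in 𝓝 x, γ (A.projExt j ⟨x, hj⟩ y) = A.projExt i ⟨x, hi⟩ y := by
  obtain ⟨Ψ, hΨx, hΨs, hΨs', hΨ⟩ := A.exists_local_diffeo hi hj
  have hsrc : ∀ᶠ y in 𝓝 x, A.pExt j y ∈ Ψ.source :=
    (A.contMDiffAt_pExt hj).continuousAt.eventually (Ψ.open_source.mem_nhds hΨx)
  obtain ⟨W₀, hW₀, hW₀o, hxW₀⟩ := eventually_nhds_iff.1
    ((hΨ.and hsrc).and (((A.U i).isOpen.eventually_mem hi).and ((A.U j).isOpen.eventually_mem hj)))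
  set W : Opens M := ⟨W₀, hW₀o⟩ with hW
  have hWi : W ≤ A.U i := fun y hy => (hW₀ y hy).2.1
  have hWj : W ≤ A.U j := fun y hy => (hW₀ y hy).2.2
  set zj := A.proj j ⟨x, hj⟩ with hzj
  set zi := A.proj i ⟨x, hi⟩ with hzi
  set cj := chartAt F zj with hcj
  set ci := chartAt F zi with hci
  have hcjm := IsManifold.chart_mem_maximalAtlas (I := 𝓘(ℝ, F)) (n := ∞) zj
  have hcim := IsManifold.chart_mem_maximalAtlas (I := 𝓘(ℝ, F)) (n := ∞) zi
  -- The diffeomorphism `Ψ` read between two summands. Its source may exceed `p j (W)`, whereas a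
  -- transition must have exactly that source; hence the restriction to `S`, which is open because
  -- submersions are.
  set γ₀ := (cj.trans Ψ).trans ci.symm with hγ₀
  have hp : ∀ y : W, cj (A.proj j ⟨y, hWj y.2⟩) = A.pExt j y := fun y =>
    (DisjUnion.chartAt_apply (z := zj) (w := A.proj j ⟨y, hWj y.2⟩) rfl).trans
      (A.pExt_apply j ⟨y, hWj y.2⟩).symm
  have hp' : ∀ y : W, Ψ (A.pExt j y) = DisjUnion.incl A.image (A.proj i ⟨y, hWi y.2⟩) := fun y =>
    (hW₀ y y.2).1.1.symm.trans (A.pExt_apply i ⟨y, hWi y.2⟩)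
  have hγapp : ∀ y : W, γ₀ (A.proj j ⟨y, hWj y.2⟩) = A.proj i ⟨y, hWi y.2⟩ := by
    intro y
    change ci.symm (Ψ (cj _)) = _
    rw [hp, hp']
    exact DisjUnion.chartAt_symm_apply (z := zi) (w := A.proj i ⟨y, hWi y.2⟩) rfl
  set S : Set A.Transverse := range (fun y : W => A.proj j ⟨y, hWj y.2⟩) with hS
  have hSsub : S ⊆ γ₀.source := by
    rintro _ ⟨y, rfl⟩
    simp only [hγ₀, OpenPartialHomeomorph.trans_source, mem_inter_iff, mem_preimage,
      OpenPartialHomeomorph.symm_source, OpenPartialHomeomorph.coe_trans, Function.comp, hp, hp']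
    exact ⟨⟨DisjUnion.mem_chartAt_source.2 rfl, (hW₀ y y.2).1.2⟩,
      DisjUnion.incl_mem_chartAt_target (z := zi) (w := A.proj i ⟨y, hWi y.2⟩) rfl⟩
  have himg : IsOpen (A.pExt j '' W₀) := by
    rw [isOpen_iff_mem_nhds]
    rintro _ ⟨y, hy, rfl⟩
    rw [← map_nhds_eq_of_submersion (A.U j).isOpen (fun z hz => A.contMDiffAt_pExt hz)
      (hWj hy) (A.mfderiv_pExt_surjective (hWj hy))]
    exact Filter.image_mem_map (hW₀o.mem_nhds hy)
  have hSo : IsOpen S := by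
    have : S = cj.source ∩ cj ⁻¹' (A.pExt j '' W₀) := by
      ext z
      constructor
      · rintro ⟨y, rfl⟩
        exact ⟨DisjUnion.mem_chartAt_source.2 rfl, y, y.2, (hp y).symm⟩
      · rintro ⟨hz, y, hy, hyz⟩
        refine ⟨⟨y, hy⟩, ?_⟩
        exact cj.injOn (x₁ := A.proj j ⟨y, hWj hy⟩) (DisjUnion.mem_chartAt_source.2 rfl) hz
          ((hp ⟨y, hy⟩).trans hyz)
    rw [this]
    exact cj.isOpen_inter_preimage himg
  have hsource : (γ₀.restrOpen S hSo).source = S := by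
    rw [OpenPartialHomeomorph.restrOpen_source]
    exact inter_eq_right.2 hSsub
  refine ⟨γ₀.restrOpen S hSo, ⟨?_, ?_, i, j, W, hWi, hWj, hsource, hγapp⟩, ?_, ?_⟩
  · intro z hz
    rw [hsource] at hz
    have hz0 := hSsub hz
    simp only [hγ₀, OpenPartialHomeomorph.trans_source, mem_inter_iff, mem_preimage,
      OpenPartialHomeomorph.symm_source, OpenPartialHomeomorph.coe_trans, Function.comp] at hz0
    have h1 : ContMDiffAt 𝓘(ℝ, F) 𝓘(ℝ, F) ∞ cj z := contMDiffAt_of_mem_maximalAtlas hcjm hz0.1.1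
    have h2 : ContMDiffAt 𝓘(ℝ, F) 𝓘(ℝ, F) ∞ Ψ (cj z) :=
      (hΨs.contDiffAt (Ψ.open_source.mem_nhds hz0.1.2)).contMDiffAt
    have h3 : ContMDiffAt 𝓘(ℝ, F) 𝓘(ℝ, F) ∞ ci.symm (Ψ (cj z)) :=
      contMDiffAt_symm_of_mem_maximalAtlas hcim hz0.2
    exact (ContMDiffAt.comp (g := ci.symm) (f := Ψ ∘ cj) z h3 (h2.comp z h1)).contMDiffWithinAt
  · intro z hz
    have hz0 : z ∈ γ₀.target := hz.1
    simp only [hγ₀, OpenPartialHomeomorph.trans_target, mem_inter_iff, mem_preimage,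
      OpenPartialHomeomorph.symm_target, OpenPartialHomeomorph.symm_symm] at hz0
    have h1 : ContMDiffAt 𝓘(ℝ, F) 𝓘(ℝ, F) ∞ ci z := contMDiffAt_of_mem_maximalAtlas hcim hz0.1
    have h2 : ContMDiffAt 𝓘(ℝ, F) 𝓘(ℝ, F) ∞ Ψ.symm (ci z) :=
      (hΨs'.contDiffAt (Ψ.open_target.mem_nhds hz0.2.1)).contMDiffAt
    have h3 : ContMDiffAt 𝓘(ℝ, F) 𝓘(ℝ, F) ∞ cj.symm (Ψ.symm (ci z)) :=
      contMDiffAt_symm_of_mem_maximalAtlas hcjm hz0.2.2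
    exact (ContMDiffAt.comp (g := cj.symm) (f := Ψ.symm ∘ ci) z h3
      (h2.comp z h1)).contMDiffWithinAt
  · rw [hsource]
    exact ⟨⟨x, hxW₀⟩, rfl⟩
  · filter_upwards [hW₀o.mem_nhds hxW₀] with y hy
    have h1 := A.projExt_apply j ⟨x, hj⟩ ⟨y, hWj hy⟩
    have h2 := A.projExt_apply i ⟨x, hi⟩ ⟨y, hWi hy⟩
    refine (congrArg γ₀ h1).trans ((hγapp ⟨y, hy⟩).trans h2.symm)

end Transitions

/-! ### The pseudogroup of local symmetries of a form -/

section Groupoid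

variable {F : Type*} [NormedAddCommGroup F] [NormedSpace ℝ F]
  {N : Type*} [TopologicalSpace N] [ChartedSpace F N] {k : ℕ}

/-- `γ` is a local diffeomorphism that preserves the form `η`. -/
def IsSymmetryOf (η : DiffForm F N k) (γ : OpenPartialHomeomorph N N) : Prop :=
  (∀ x ∈ γ.source, ContMDiffAt 𝓘(ℝ, F) 𝓘(ℝ, F) ∞ γ x ∧ η x = pullback γ η x) ∧
    ∀ y ∈ γ.target, ContMDiffAt 𝓘(ℝ, F) 𝓘(ℝ, F) ∞ γ.symm y

/-- Replace `η` at the preimage of `y` by its pullback by `γ`: the two pullbacks compose to that of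
the identity near `y`. -/
theorem IsSymmetryOf.pullback_symm {η : DiffForm F N k} {γ : OpenPartialHomeomorph N N}
    (h : IsSymmetryOf η γ) {y : N} (hy : y ∈ γ.target) : η y = pullback γ.symm η y := by
  have hx := γ.map_target hy
  rw [pullback_congr_form (h.1 _ hx).2, ← pullback_comp_apply η
    ((h.1 _ hx).1.mdifferentiableAt (by simp)) ((h.2 y hy).mdifferentiableAt (by simp))]
  have hev : γ ∘ γ.symm =ᶠ[𝓝 y] id := by
    filter_upwards [γ.open_target.mem_nhds hy] with z hz
    exact γ.right_inv hz
  rw [pullback_congr_map hev, pullback_id_apply]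

/-- The pseudogroup of the local diffeomorphisms that preserve the form `η`. -/
def symmetryGroupoid (η : DiffForm F N k) : StructureGroupoid N where
  members := {γ | IsSymmetryOf η γ}
  trans' := by
    intro e e' he he'
    refine ⟨fun x hx => ?_, fun y hy => ?_⟩
    · rw [OpenPartialHomeomorph.trans_source] at hx
      have h1 := he.1 x hx.1
      have h2 := he'.1 (e x) hx.2
      refine ⟨h2.1.comp x h1.1, ?_⟩
      rw [h1.2, pullback_congr_form h2.2]
      exact (pullback_comp_apply η (h2.1.mdifferentiableAt (by simp))
        (h1.1.mdifferentiableAt (by simp))).symm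
    · rw [OpenPartialHomeomorph.trans_target] at hy
      exact ContMDiffAt.comp y (g := e.symm) (f := e'.symm) (he.2 _ hy.2) (he'.2 y hy.1)
  symm' := fun e he => ⟨fun y hy => ⟨he.2 y hy, he.pullback_symm hy⟩, fun x hx => (he.1 x hx).1⟩
  id_mem' := ⟨fun x _ => ⟨contMDiffAt_id, (pullback_id_apply η x).symm⟩,
    fun _ _ => contMDiffAt_id⟩
  locality' := by
    intro e he
    refine ⟨fun x hx => ?_, fun y hy => ?_⟩
    · obtain ⟨s, hs, hxs, h⟩ := he x hx
      exact h.1 x (by rw [e.restr_source' s hs]; exact ⟨hx, hxs⟩)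
    · obtain ⟨s, hs, hxs, h⟩ := he _ (e.map_target hy)
      refine h.2 y ?_
      have h1 := (e.restr s).map_source
        (show e.symm y ∈ (e.restr s).source by
          rw [e.restr_source' s hs]; exact ⟨e.map_target hy, hxs⟩)
      rwa [e.restr_apply, e.right_inv hy] at h1
  mem_of_eqOnSource' := by
    intro e e' he h
    refine ⟨fun x hx => ?_, fun y hy => ?_⟩
    · have hev : e' =ᶠ[𝓝 x] e := by
        filter_upwards [e'.open_source.mem_nhds hx] with z hz
        exact h.2 hz
      have h1 := he.1 x (h.1 ▸ hx)
      exact ⟨h1.1.congr_of_eventuallyEq hev, h1.2.trans (pullback_congr_map hev η).symm⟩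
    · have hs := h.symm'
      have hev : e'.symm =ᶠ[𝓝 y] e.symm := by
        filter_upwards [e'.open_target.mem_nhds hy] with z hz
        exact hs.2 hz
      exact (he.2 y (h.target_eq ▸ hy)).congr_of_eventuallyEq hev

instance (η : DiffForm F N k) : ClosedUnderRestriction (symmetryGroupoid η) where
  closedUnderRestriction := by
    intro e he s hs
    refine ⟨fun x hx => ?_, fun y hy => ?_⟩
    · rw [e.restr_source' s hs] at hx
      exact he.1 x hx.1
    · exact he.2 y hy.1

end Groupoid

/-! ### The correspondence between forms on `M` and on the transverse manifold -/

section Correspondence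

variable {E : Type*} [NormedAddCommGroup E] [NormedSpace ℝ E] [CompleteSpace E]
  {F : Type*} [NormedAddCommGroup F] [NormedSpace ℝ F] [CompleteSpace F]
  {M : Type*} [TopologicalSpace M] [ChartedSpace E M]
  {ℱ : Foliation E F M} {ι : Type*} {A : FoliatedAtlas ℱ ι} {k l : ℕ}

namespace FoliatedAtlas

variable (A) in
/-- On every `U i`, the form `ξ` is the pullback of `η` by the projection to the transverse
manifold. -/
def Corresponds (ξ : DiffForm E M k) (η : DiffForm F A.Transverse k) : Prop :=
  ∀ i, pullback (E := E) (Subtype.val : A.U i → M) ξ = pullback (E := E) (A.proj i) η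

namespace Corresponds

variable {ξ ξ' : DiffForm E M k} {η η' : DiffForm F A.Transverse k}

/-- Both sides agree after pullback to `U i`, and the inclusion has surjective differential. -/
theorem eq_pullback (h : A.Corresponds ξ η) {i : ι} (x₀ : A.U i) {x : M} (hx : x ∈ A.U i) :
    ξ x = pullback (E := E) (A.projExt i x₀) η x :=
  eq_of_pullback_eq (f := (Subtype.val : A.U i → M)) (x := ⟨x, hx⟩)
    (mfderiv_val_surjective (E := E) _)
    ((congrFun (h i) ⟨x, hx⟩).trans (A.pullback_proj x₀ ⟨x, hx⟩ η))

theorem of_eq_pullback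
    (h : ∀ (i : ι) (x : A.U i), ξ x = pullback (E := E) (A.projExt i x) η x) :
    A.Corresponds ξ η := by
  intro i
  funext x
  rw [A.pullback_proj x x η]
  exact pullback_congr_form (h i x)

theorem add (h : A.Corresponds ξ η) (h' : A.Corresponds ξ' η') :
    A.Corresponds (ξ + ξ') (η + η') := by
  intro i
  funext x
  exact congrArg₂ (· + ·) (congrFun (h i) x) (congrFun (h' i) x)

theorem smul (c : ℝ) (h : A.Corresponds ξ η) : A.Corresponds (c • ξ) (c • η) := by
  intro i
  funext x
  exact congrArg (c • ·) (congrFun (h i) x)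

theorem left_unique (h : A.Corresponds ξ η) (h' : A.Corresponds ξ' η) : ξ = ξ' := by
  funext x
  obtain ⟨i, hi⟩ := A.covers x
  rw [h.eq_pullback ⟨x, hi⟩ hi, h'.eq_pullback ⟨x, hi⟩ hi]

/-- Every point of the transverse manifold is the projection of a point of some `U i`, where
pullback is injective. -/
theorem right_unique (h : A.Corresponds ξ η) (h' : A.Corresponds ξ η') : η = η' := by
  funext z
  obtain ⟨i, y, x, rfl⟩ := z
  exact eq_of_pullback_eq (f := A.proj i) (x := x) (A.mfderiv_proj_surjective i x)
    ((congrFun (h i) x).symm.trans (congrFun (h' i) x))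

/-- Naturality of `d`, for the inclusion on one side and for the projection on the other. -/
theorem extDer [IsManifold 𝓘(ℝ, E) ∞ M] (h : A.Corresponds ξ η) (hξ : IsSmoothForm ξ)
    (hη : IsSmoothForm η) : A.Corresponds (extDer ξ) (extDer η) := by
  intro i
  funext x
  rw [← extDer_pullback (isSmoothForm_iff.1 hξ _) (contMDiff_subtype_val x), h i,
    extDer_pullback (isSmoothForm_iff.1 hη _) (A.contMDiff_proj i x)]

theorem wedge {ξ₂ : DiffForm E M l} {η₂ : DiffForm F A.Transverse l} (h : A.Corresponds ξ η)
    (h₂ : A.Corresponds ξ₂ η₂) : A.Corresponds (wedge ξ ξ₂) (wedge η η₂) := by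
  intro i
  rw [pullback_wedge, pullback_wedge, h i, h₂ i]

theorem one : A.Corresponds oneForm oneForm := by
  intro i
  rw [pullback_oneForm, pullback_oneForm]

theorem isSmoothForm [IsManifold 𝓘(ℝ, E) ∞ M] (h : A.Corresponds ξ η) (hη : IsSmoothForm η) :
    IsSmoothForm ξ := by
  rw [isSmoothForm_iff]
  intro x
  obtain ⟨i, hi⟩ := A.covers x
  refine ((isSmoothForm_iff.1 hη _).pullback (A.contMDiffAt_projExt ⟨x, hi⟩ hi)).congr ?_
  filter_upwards [(A.U i).isOpen.mem_nhds hi] with y hy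
  exact h.eq_pullback ⟨x, hi⟩ hy

theorem kills (h : A.Corresponds ξ η) {x : M} {v : TangentSpace 𝓘(ℝ, E) x}
    (hv : v ∈ ℱ.tangent x) : Kills (ξ x) v := by
  obtain ⟨i, hi⟩ := A.covers x
  rw [h.eq_pullback ⟨x, hi⟩ hi]
  refine Kills.compContinuousLinearMap ?_
  rw [A.mfderiv_projExt_eq_zero ⟨x, hi⟩ hi hv]
  exact kills_zero _

/-- The form on the transverse manifold is preserved by the holonomy pseudogroup. -/
theorem mem_invariantForms (h : A.Corresponds ξ η) (hη : IsSmoothForm η) :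
    η ∈ invariantForms F A.holonomyPseudogroup k := by
  -- By minimality of the generated pseudogroup, only the elements of the cocycle have to be
  -- checked.
  have hle : A.holonomyPseudogroup ≤ symmetryGroupoid η := by
    refine sInf_le ⟨inferInstance, ?_⟩
    rintro γ ⟨hγ, hγ', i, j, W, hi, hj, hsrc, happ⟩
    refine ⟨fun z hz => ?_, fun y hy => hγ'.contMDiffAt (γ.open_target.mem_nhds hy)⟩
    have hγz := hγ.contMDiffAt (γ.open_source.mem_nhds hz)
    refine ⟨hγz, ?_⟩
    rw [hsrc] at hz
    obtain ⟨x, rfl⟩ := hz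
    have hxj := A.projExt_apply j ⟨x, hj x.2⟩ ⟨x, hj x.2⟩
    have hγx : ContMDiffAt 𝓘(ℝ, F) 𝓘(ℝ, F) ∞ γ (A.projExt j ⟨x, hj x.2⟩ x) := by
      rw [hxj]; exact hγz
    have hev : γ ∘ A.projExt j ⟨x, hj x.2⟩ =ᶠ[𝓝 (x : M)] A.projExt i ⟨x, hi x.2⟩ := by
      filter_upwards [W.isOpen.mem_nhds x.2] with y hy
      have h1 := A.projExt_apply j ⟨x, hj x.2⟩ ⟨y, hj hy⟩
      have h2 := A.projExt_apply i ⟨x, hi x.2⟩ ⟨y, hi hy⟩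
      exact (congrArg γ h1).trans ((happ ⟨y, hy⟩).trans h2.symm)
    -- Pulled back to `M`, both sides become `ξ x`: the left one by the correspondence on `U j`, the
    -- right one by that on `U i`, as `γ ∘ p j = p i`.
    have key : η (A.projExt j ⟨x, hj x.2⟩ x) = pullback γ η (A.projExt j ⟨x, hj x.2⟩ x) := by
      refine eq_of_pullback_eq (E := E) (A.mfderiv_projExt_surjective ⟨x, hj x.2⟩ (hj x.2)) ?_
      rw [← h.eq_pullback _ (hj x.2), ← pullback_comp_apply η (hγx.mdifferentiableAt (by simp))
        ((A.contMDiffAt_projExt _ (hj x.2)).mdifferentiableAt (by simp)), pullback_congr_map hev,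
        ← h.eq_pullback _ (hi x.2)]
    rwa [hxj] at key
  exact ⟨hη, fun γ hγ x hx => ((hle hγ).1 x hx).2⟩

end Corresponds

/-- The elements of the Haefliger cocycle belong to the holonomy pseudogroup. -/
theorem IsTransition.mem_holonomyPseudogroup
    {γ : OpenPartialHomeomorph A.Transverse A.Transverse} (h : A.IsTransition γ) :
    γ ∈ A.holonomyPseudogroup := by
  have : ∀ G ∈ {G : StructureGroupoid A.Transverse | ClosedUnderRestriction G ∧
      {γ | A.IsTransition γ} ⊆ G.members}, γ ∈ G := fun G hG => hG.2 h
  exact mem_iInter₂.2 this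

section FiniteDimensional

variable [FiniteDimensional ℝ F] [IsManifold 𝓘(ℝ, E) ∞ M]

/-- An invariant form on the transverse manifold lifts to `M`. -/
theorem exists_corresponds_of_invariant {η : DiffForm F A.Transverse k}
    (hη : η ∈ invariantForms F A.holonomyPseudogroup k) : ∃ ξ, A.Corresponds ξ η := by
  -- At each point the lift uses one chosen index; invariance under a transition shows that every
  -- other index gives the same value.
  choose i hi using A.covers
  refine ⟨fun x => pullback (E := E) (A.projExt (i x) ⟨x, hi x⟩) η x,
    Corresponds.of_eq_pullback ?_⟩
  rintro j ⟨x, hj⟩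
  obtain ⟨γ, hγ, hx, hev⟩ := A.exists_transition (hi x) hj
  have hxj := A.projExt_apply j ⟨x, hj⟩ ⟨x, hj⟩
  rw [← hxj] at hx
  have hγx : ContMDiffAt 𝓘(ℝ, F) 𝓘(ℝ, F) ∞ γ (A.projExt j ⟨x, hj⟩ x) :=
    hγ.1.contMDiffAt (γ.open_source.mem_nhds hx)
  have h1 : γ ∘ A.projExt j ⟨x, hj⟩ =ᶠ[𝓝 x] A.projExt (i x) ⟨x, hi x⟩ := hev
  change pullback (E := E) (A.projExt (i x) ⟨x, hi x⟩) η x = pullback (A.projExt j ⟨x, hj⟩) η x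
  rw [← pullback_congr_map h1, pullback_comp_apply η (hγx.mdifferentiableAt (by simp))
    ((A.contMDiffAt_projExt _ hj).mdifferentiableAt (by simp))]
  exact pullback_congr_form (hη.2 γ hγ.mem_holonomyPseudogroup _ hx).symm

/-- Closure is obtained by lifting to `M`: the results of the operations correspond to forms on `M`,
which forces invariance. -/
theorem isSubDGA_invariantForms (A : FoliatedAtlas ℱ ι) :
    IsSubDGA (invariantForms F A.holonomyPseudogroup) where
  d_mem k η hη := by
    obtain ⟨ξ, h⟩ := exists_corresponds_of_invariant hη
    exact (h.extDer (h.isSmoothForm hη.1) hη.1).mem_invariantForms hη.1.extDer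
  d_d k η hη := hη.1.extDer_extDer
  one_mem := (Corresponds.one (A := A)).mem_invariantForms isSmoothForm_oneForm
  wedge_mem k l η hη η' hη' := by
    obtain ⟨ξ, h⟩ := exists_corresponds_of_invariant hη
    obtain ⟨ξ', h'⟩ := exists_corresponds_of_invariant hη'
    exact (h.wedge h').mem_invariantForms (hη.1.wedge hη'.1)

variable [FiniteDimensional ℝ E] [T2Space M]

/-- A basic form descends to the transverse manifold. -/
theorem exists_corresponds_of_basic {ξ : DiffForm E M k} (hξ : ξ ∈ basicForms ℱ k) :
    ∃ η : DiffForm F A.Transverse k, IsSmoothForm η ∧ A.Corresponds ξ η := by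
  obtain ⟨hs, hk⟩ := mem_basicForms_iff.1 hξ
  choose b hbs hb using fun i => exists_descent (f := A.pExt i) (A.U i).isOpen
    (fun x hx => A.contMDiffAt_pExt hx) (fun x hx => A.mfderiv_pExt_surjective hx)
    (A.isPreconnected_fibre_pExt i) (fun x _ => isSmoothForm_iff.1 hs x)
    (fun x hx v hv => hk x v ((A.mem_tangent_iff hx v).2 hv))
  -- On the summand of index `i`, the form is the descent `b i` of `ξ` along `p i`; no compatibility
  -- between summands is needed.
  refine ⟨fun z => pullback (E := F) (DisjUnion.incl A.image) (b z.1) z, ?_, fun i => ?_⟩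
  · rw [isSmoothForm_iff]
    rintro ⟨i, y, x, rfl⟩
    have h1 : SmoothFormAt (b i) (DisjUnion.incl A.image (A.proj i x)) := by
      have := hbs i x x.2
      rwa [A.pExt_apply] at this
    refine (h1.pullback (DisjUnion.contMDiffAt_incl (A.proj i x))).congr ?_
    filter_upwards [DisjUnion.eventually_fst_eq (A.proj i x)] with w hw
    have hw' : w.1 = i := hw
    change pullback (E := F) (DisjUnion.incl A.image) (b w.1) w = _
    rw [hw']
  · funext x
    rw [pullback_congr_form (hb i x x.2)]
    have h1 := pullback_extend_val (E := E) (fun _ => 0) ((A.submersion i).1 x) (b i)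
    exact h1.symm.trans (A.pullback_p i x (b i))

/-- Tangent vectors annihilate any form corresponding to one downstairs; this applies to `ξ` and
also to `dξ`, which corresponds to `dη`. -/
theorem Corresponds.mem_basicForms {ξ : DiffForm E M k} {η : DiffForm F A.Transverse k}
    (h : A.Corresponds ξ η) (hη : IsSmoothForm η) : ξ ∈ basicForms ℱ k := by
  have hs := h.isSmoothForm hη
  exact mem_basicForms_iff.2 ⟨hs, fun x v hv => ⟨h.kills hv, (h.extDer hs hη).kills hv⟩⟩

theorem isSubDGA_basicForms (A : FoliatedAtlas ℱ ι) : IsSubDGA (basicForms ℱ) where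
  d_mem k ξ hξ := by
    obtain ⟨η, hη, h⟩ := exists_corresponds_of_basic (A := A) hξ
    exact (h.extDer hξ.1 hη).mem_basicForms hη.extDer
  d_d k ξ hξ := hξ.1.extDer_extDer
  one_mem := (Corresponds.one (A := A)).mem_basicForms isSmoothForm_oneForm
  wedge_mem k l ξ hξ ξ' hξ' := by
    obtain ⟨η, hη, h⟩ := exists_corresponds_of_basic (A := A) hξ
    obtain ⟨η', hη', h'⟩ := exists_corresponds_of_basic (A := A) hξ'
    exact (h.wedge h').mem_basicForms (hη.wedge hη')

variable (A) in
/-- The isomorphism between the basic forms and the invariant forms on the transverse manifold. -/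
theorem exists_linearEquiv (k : ℕ) :
    ∃ Ξ : basicForms ℱ k ≃ₗ[ℝ] invariantForms F A.holonomyPseudogroup k,
      ∀ ξ, A.Corresponds ξ.1 (Ξ ξ).1 := by
  -- Linearity of the chosen map comes from uniqueness downstairs, injectivity from uniqueness
  -- upstairs, surjectivity from lifting invariant forms.
  choose Ξ hΞs hΞ using fun ξ : basicForms ℱ k => exists_corresponds_of_basic (A := A) ξ.2
  let L : basicForms ℱ k →ₗ[ℝ] invariantForms F A.holonomyPseudogroup k :=
    { toFun := fun ξ => ⟨Ξ ξ, (hΞ ξ).mem_invariantForms (hΞs ξ)⟩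
      map_add' := fun ξ ξ' => Subtype.ext ((hΞ _).right_unique ((hΞ ξ).add (hΞ ξ')))
      map_smul' := fun c ξ => Subtype.ext ((hΞ _).right_unique ((hΞ ξ).smul c)) }
  refine ⟨LinearEquiv.ofBijective L ⟨fun ξ ξ' h => ?_, fun η => ?_⟩, hΞ⟩
  · have h1 : Ξ ξ = Ξ ξ' := congrArg Subtype.val h
    have h2 := hΞ ξ'
    rw [← h1] at h2
    exact Subtype.ext ((hΞ ξ).left_unique h2)
  · obtain ⟨ξ, h⟩ := exists_corresponds_of_invariant η.2
    exact ⟨⟨ξ, h.mem_basicForms η.2.1⟩, Subtype.ext ((hΞ _).right_unique h)⟩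

end FiniteDimensional

end FoliatedAtlas

end Correspondence

end FoliatedForms

end

/-- Each identity holds because its two sides correspond to the same form on `M`, and such a form
downstairs is unique. -/
theorem mainTheorem8 (p n : ℕ) {M : Type*} [TopologicalSpace M] [T2Space M]
    [ChartedSpace (EuclideanSpace ℝ (Fin (p + 2 * n))) M]
    [IsManifold 𝓘(ℝ, EuclideanSpace ℝ (Fin (p + 2 * n))) ∞ M]
    (ℱ : FoliatedForms.Foliation (EuclideanSpace ℝ (Fin (p + 2 * n)))
      (EuclideanSpace ℝ (Fin (2 * n))) M)
    {ι : Type*} (A : FoliatedForms.FoliatedAtlas ℱ ι) :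
    ∃ (hB : FoliatedForms.IsSubDGA (FoliatedForms.basicForms ℱ))
      (hΓ : FoliatedForms.IsSubDGA (FoliatedForms.invariantForms (EuclideanSpace ℝ (Fin (2 * n))) A.holonomyPseudogroup))
      (Ξ : ∀ k : ℕ, FoliatedForms.basicForms ℱ k ≃ₗ[ℝ]
        FoliatedForms.invariantForms (EuclideanSpace ℝ (Fin (2 * n))) A.holonomyPseudogroup k),
      (∀ (k : ℕ) (ξ : FoliatedForms.basicForms ℱ k), Ξ (k + 1) (hB.d ξ) = hΓ.d (Ξ k ξ)) ∧
      (∀ (k : ℕ) (ξ : FoliatedForms.basicForms ℱ k) (i : ι),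
        FoliatedForms.pullback (E := EuclideanSpace ℝ (Fin (p + 2 * n))) (Subtype.val : A.U i → M) ξ.1 =
          FoliatedForms.pullback (E := EuclideanSpace ℝ (Fin (p + 2 * n))) (A.proj i) (Ξ k ξ).1) ∧
      (∀ (k l : ℕ) (ξ : FoliatedForms.basicForms ℱ k) (η : FoliatedForms.basicForms ℱ l),
        Ξ (k + l) (hB.mul ξ η) = hΓ.mul (Ξ k ξ) (Ξ l η)) ∧
      Ξ 0 hB.one = hΓ.one := by
  choose Ξ hΞ using fun k => FoliatedForms.FoliatedAtlas.exists_linearEquiv A k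
  have hB := FoliatedForms.FoliatedAtlas.isSubDGA_basicForms A
  have hΓ := FoliatedForms.FoliatedAtlas.isSubDGA_invariantForms A
  refine ⟨hB, hΓ, Ξ, fun k ξ => ?_, fun k ξ i => hΞ k ξ i, fun k l ξ η => ?_, ?_⟩
  · exact Subtype.ext ((hΞ _ (hB.d ξ)).right_unique
      ((hΞ k ξ).extDer ξ.2.1 (Ξ k ξ).2.1))
  · exact Subtype.ext ((hΞ _ (hB.mul ξ η)).right_unique ((hΞ k ξ).wedge (hΞ l η)))
  · exact Subtype.ext ((hΞ 0 hB.one).right_unique FoliatedForms.FoliatedAtlas.Corresponds.one)
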